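/- For a graph $G$ and a partition $V(G)=X\sqcup Y$, let $G[X,Y]$ denote the spanning bipartite subgraph of $G$ consisting of all edges of $G$ between $X$ and $Y$. For a bipartite graph $H$ and positive integers $n,s$, let $\mathrm{ex}^*_{\mathrm{bip}}(n,H,s)$ be the minimum $M$ such that, for every $n$-vertex graph $G$ that contains no copy of $K_{s,s}$ as a (not necessarily induced) subgraph and every partition of $V(G)$ into $X,Y$, if $e(G[X,Y])>M$ then $G[X,Y]$ contains a copy of $H$ that is an induced subgraph of $G$. For positive integers $r,t$, let $T_{r,t}$ be the tree obtained from the star with $r$ leaves by joining $t$ new leaves to each leaf of the star, and let $R$ be the set of leaves of $T_{r,t}$. For a positive integer $\ell$, let $F^\ell_{r,t}$ be the $\ell$-th power of $T_{r,t}$ rooted at $R$, that is, the union of $\ell$ copies of $T_{r,t}$ in which, for each $v\in R$, the $\ell$ images of $v$ are identified and which are otherwise pairwise vertex-disjoint. **Theorem.** Let $\ell,r,s,t$ be positive integers with $r\ge t+2\ge 3$. Then, as $n\to\infty$, $$\mathrm{ex}^*_{\mathrm{bip}}(n,F^\ell_{r,t},s)=O\!\left(n^{2-\frac{r+1}{rt+r}}\right),$$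 where the implied constant depends only on $\ell,r,s,t$. -/

import Mathlib

namespace InducedTuran

/-- The spanning bipartite subgraph `G[X, Xᶜ]` contains a copy of `H` that is an induced
subgraph of `G`: there is an embedding of `H` in `G` as an induced subgraph all of whose edges
go between `X` and its complement. -/
def HasInducedCopyAcross {W V : Type*} (H : SimpleGraph W) (G : SimpleGraph V) (X : Set V) :
    Prop :=
  ∃ f : H ↪g G, ∀ u v : W, H.Adj u v → (G.between X Xᶜ).Adj (f u) (f v)

/-- `M` is a threshold for `n`, `H`, `s`: for every `K_{s,s}`-free graph `G` on `n` vertices and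
every partition `X, Xᶜ` of its vertex set, if `G[X, Xᶜ]` has more than `M` edges then it contains
a copy of `H` that is an induced subgraph of `G`. -/
def IsThreshold {W : Type*} (n : ℕ) (H : SimpleGraph W) (s M : ℕ) : Prop :=
  ∀ (G : SimpleGraph (Fin n)) (X : Set (Fin n)),
    (completeBipartiteGraph (Fin s) (Fin s)).Free G →
    M < (G.between X Xᶜ).edgeSet.ncard →
    HasInducedCopyAcross H G X

/-- The bipartite induced Turán number `ex*_bip(n, H, s)`: the least threshold. -/
noncomputable def exBip {W : Type*} (n : ℕ) (H : SimpleGraph W) (s : ℕ) : ℕ :=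
  sInf {M : ℕ | IsThreshold n H s M}

/-- Thresholds exist, so the infimum in `exBip` is a minimum. -/
theorem isThreshold_exBip {W : Type*} (n : ℕ) (H : SimpleGraph W) (s : ℕ) :
    IsThreshold n H s (exBip n H s) := by
  refine Nat.sInf_mem (s := {M : ℕ | IsThreshold n H s M})
    ⟨(Set.univ : Set (Sym2 (Fin n))).ncard, ?_⟩
  intro G X _ h
  exact absurd (Set.ncard_le_ncard (Set.subset_univ _) Set.finite_univ) (not_le.mpr h)

/-- The `ℓ`-th power of `F` rooted at `R`: `ℓ` copies of `F`, glued along `R` and otherwise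
disjoint. The vertices are the elements of `R` and the pairs `(i, v)` with `i` the label of a
copy and `v` a vertex outside `R`. -/
def rootedPower {V : Type*} (F : SimpleGraph V) (R : Set V) (ℓ : ℕ) :
    SimpleGraph (R ⊕ (Fin ℓ × (Rᶜ : Set V))) where
  Adj
    | .inl a, .inl b => F.Adj a b
    | .inl a, .inr (_, b) => F.Adj a b
    | .inr (_, a), .inl b => F.Adj a b
    | .inr (i, a), .inr (j, b) => i = j ∧ F.Adj a b
  symm := ⟨by
    rintro (a | ⟨i, a⟩) (b | ⟨j, b⟩) h
    · exact h.symm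
    · exact h.symm
    · exact h.symm
    · exact ⟨h.1.symm, h.2.symm⟩⟩
  loopless := ⟨by
    rintro (a | ⟨i, a⟩) h
    · exact h.ne rfl
    · exact h.2.ne rfl⟩

/-- The set of leaves (vertices of degree one) of a graph. -/
def leaves {V : Type*} (G : SimpleGraph V) : Set V :=
  {v | ∃! w, G.Adj v w}

/-- The height-two tree `T_{r,t}`: the centre `inl ()` is joined to the `r` vertices
`inr (inl i)`, and each `inr (inl i)` is joined to the `t` vertices `inr (inr (i, j))`. -/
def heightTwoTree (r t : ℕ) : SimpleGraph (Unit ⊕ Fin r ⊕ Fin r × Fin t) :=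
  SimpleGraph.fromRel fun u v =>
    match u, v with
    | .inl _, .inr (.inl _) => True
    | .inr (.inl i), .inr (.inr (k, _)) => i = k
    | _, _ => False

/-- The graph `F^ℓ_{r,t}`: the `ℓ`-th power of `T_{r,t}` rooted at its set of leaves. -/
def heightTwoPower (r t ℓ : ℕ) :=
  rootedPower (heightTwoTree r t) (leaves (heightTwoTree r t)) ℓ

end InducedTuran

/-!
Pass to an almost regular bipartite piece, with parts of size about `m` and degrees about
`Δ ≥ C * m ^ ((r * t - 1) / (r * (t + 1)))`. Since `G` is `K_{s,s}`-free, two large sets of vertices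
have few pairs that are equal or adjacent, so vertices chosen at random from large sets span no
unwanted edges.

Suppose there is no induced copy of `F^ℓ_{r,t}` across the piece. Then in every large set a positive
proportion of the `(t + 1)`-tuples is light: pairwise distinct and nonadjacent and with few common
neighbours. Hence a positive proportion of the copies of `T_{r,t}` is good: induced, with light
branches. By the sunflower lemma, for all but `O(m ^ (r * t))` good copies, and so for most of them,
there is a set `S` of branches such that the copy lies in a kernel for `S`: many good copies that
agree on the leaves and on the middle vertices of `S` and are otherwise pairwise disjoint.

A branch of `S` can be erased once it has many possible middle vertices with the same leaves. If
this failed for most copies, then, light tuples of centres having few common neighbours, a double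
count would contradict `Δ ^ (t ^ 2 + t + 1) ≥ C * m ^ (t ^ 2)`, which is where `r ≥ t + 2` enters. A
kernel for the empty set remains, and `ℓ` random copies from it form an induced `F^ℓ_{r,t}`.
-/

namespace InducedTuran

open Finset Function
open scoped Classical

section RandomChoice

variable {κ : Type*} [Fintype κ] [DecidableEq κ]

theorem sum_sum_update {Ω : κ → Type*} [∀ c, Fintype (Ω c)] (f : (∀ c, Ω c) → ℕ) (a : κ) :
    ∑ ω, ∑ x, f (update ω a x) = Fintype.card (Ω a) * ∑ ω, f ω :=
  calc ∑ ω, ∑ x, f (update ω a x)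
      = ∑ q : (∀ c, Ω c) × Ω a, f (update q.1 a q.2) :=
        (Fintype.sum_prod_type' fun ω x => f (update ω a x)).symm
    _ = ∑ q : (∀ c, Ω c) × Ω a, f q.1 :=
        sum_nbij' (fun q => (update q.1 a q.2, q.1 a)) (fun q => (update q.1 a q.2, q.1 a))
          (by simp) (by simp) (by simp) (by simp) (by simp)
    _ = Fintype.card (Ω a) * ∑ ω, f ω := by
        rw [Fintype.sum_prod_type' fun ω _ => f ω, mul_sum]
        simp only [sum_const, card_univ, smul_eq_mul]

theorem sum_card_filter_update_update {Ω : κ → Type*} [∀ c, Fintype (Ω c)]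
    (E : (∀ c, Ω c) → Prop) (a b : κ) :
    ∑ ω, #{q : Ω a × Ω b | E (update (update ω b q.2) a q.1)} =
      Fintype.card (Ω b) * (Fintype.card (Ω a) * #{ω | E ω}) := by
  simp only [card_filter, Fintype.sum_prod_type_right]
  rw [sum_sum_update (fun ω => ∑ x, if E (update ω a x) then 1 else 0) b,
    sum_sum_update (fun ω => if E ω then 1 else 0) a]

variable {Ω V : Type*} [Fintype Ω]

theorem card_filter_le_of_update_update (E : (κ → Ω) → Prop) (a b : κ) {η : ℝ}
    (hE : ∀ ω, (#{q : Ω × Ω | E (update (update ω b q.2) a q.1)} : ℝ) ≤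
      η * Fintype.card Ω * Fintype.card Ω) :
    (#{ω | E ω} : ℝ) ≤ η * Fintype.card (κ → Ω) := by
  rcases isEmpty_or_nonempty (κ → Ω) with _ | ⟨⟨ω₀⟩⟩
  · simp
  have hΩ : (0 : ℝ) < Fintype.card Ω := Nat.cast_pos.2 (Fintype.card_pos_iff.2 ⟨ω₀ a⟩)
  have hsum : (Fintype.card Ω * (Fintype.card Ω * #{ω | E ω}) : ℝ) ≤
      Fintype.card (κ → Ω) * (η * Fintype.card Ω * Fintype.card Ω) := by
    have := sum_le_sum fun ω (_ : ω ∈ univ) => hE ω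
    rw [sum_const, card_univ, nsmul_eq_mul, ← Nat.cast_sum,
      sum_card_filter_update_update (Ω := fun _ => Ω)] at this
    exact_mod_cast this
  refine le_of_mul_le_mul_left (le_of_eq_of_le ?_ (hsum.trans_eq ?_)) (mul_pos hΩ hΩ) <;> ring

/-- Two vertices that depend on a random choice `ω` of coordinates are driven apart by `a` and `b`
if each is an injective function of its own one of these coordinates and does not depend on the
other one. -/
structure DrivenApart (u v : (κ → Ω) → V) (a b : κ) : Prop where
  ne : a ≠ b
  injective_left ω : Injective fun x => u (update ω a x)
  injective_right ω : Injective fun x => v (update ω b x)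
  left_update ω x : u (update ω b x) = u ω
  right_update ω x : v (update ω a x) = v ω

/-- Two vertices clash if they are equal or adjacent. -/
def Clash (G : SimpleGraph V) (u v : V) : Prop := u = v ∨ G.Adj u v

theorem Clash.symm {G : SimpleGraph V} {u v : V} (h : Clash G u v) : Clash G v u :=
  h.imp Eq.symm SimpleGraph.Adj.symm

/-- Only a proportion `η` of the pairs between any two sets of at least `N` vertices clash. -/
def FewClashes (G : SimpleGraph V) (N : ℕ) (η : ℝ) : Prop :=
  ∀ A B : Finset V, N ≤ #A → N ≤ #B → (#{q ∈ A ×ˢ B | Clash G q.1 q.2} : ℝ) ≤ η * #A * #B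

variable {G : SimpleGraph V} {N : ℕ} {η : ℝ}

theorem FewClashes.card_filter_le_of_injective {f g : Ω → V} (hG : FewClashes G N η)
    (hf : Injective f) (hg : Injective g) (hN : N ≤ Fintype.card Ω) :
    (#{q : Ω × Ω | Clash G (f q.1) (g q.2)} : ℝ) ≤ η * Fintype.card Ω * Fintype.card Ω := by
  have hcard {h : Ω → V} (hh : Injective h) : #(univ.image h) = Fintype.card Ω := by
    rw [card_image_of_injective _ hh, card_univ]
  have key := hG (univ.image f) (univ.image g) (by rwa [hcard hf]) (by rwa [hcard hg])
  rw [hcard hf, hcard hg] at key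
  refine le_trans (Nat.cast_le.2 ?_) key
  refine card_le_card_of_injOn (Prod.map f g) (fun q hq => ?_) (hf.prodMap hg).injOn
  simpa using hq

theorem FewClashes.card_clash_le {u v : (κ → Ω) → V} {a b : κ} (hG : FewClashes G N η)
    (h : DrivenApart u v a b) (hN : N ≤ Fintype.card Ω) :
    (#{ω | Clash G (u ω) (v ω)} : ℝ) ≤ η * Fintype.card (κ → Ω) := by
  refine card_filter_le_of_update_update _ a b fun ω => ?_
  have key := hG.card_filter_le_of_injective (h.injective_left ω) (h.injective_right ω) hN
  simp only [h.right_update]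
  simpa only [update_comm h.ne.symm, h.left_update] using key

theorem FewClashes.card_exists_clash_le {I : Type*} [Fintype I] {u : I → (κ → Ω) → V} {c : I → κ}
    {R : I → I → Prop} [DecidableRel R] (hG : FewClashes G N η) (hη : 0 ≤ η)
    (hN : N ≤ Fintype.card Ω) (hu : ∀ p q, R p q → DrivenApart (u p) (u q) (c p) (c q)) :
    (#{ω | ∃ p q, R p q ∧ Clash G (u p ω) (u q ω)} : ℝ) ≤
      Fintype.card I ^ 2 * η * Fintype.card (κ → Ω) := by
  have hsub : ({ω | ∃ p q, R p q ∧ Clash G (u p ω) (u q ω)} : Finset (κ → Ω)) ⊆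
      univ.biUnion fun q : I × I => {ω | R q.1 q.2 ∧ Clash G (u q.1 ω) (u q.2 ω)} := by
    intro ω
    simp
  have hpair (q : I × I) : (#{ω | R q.1 q.2 ∧ Clash G (u q.1 ω) (u q.2 ω)} : ℝ) ≤
      η * Fintype.card (κ → Ω) := by
    by_cases hq : R q.1 q.2
    · simpa only [hq, true_and] using hG.card_clash_le (hu _ _ hq) hN
    · simp only [hq, false_and, filter_false, card_empty, Nat.cast_zero]
      positivity
  calc (#{ω | ∃ p q, R p q ∧ Clash G (u p ω) (u q ω)} : ℝ)
      ≤ ∑ q : I × I, (#{ω | R q.1 q.2 ∧ Clash G (u q.1 ω) (u q.2 ω)} : ℝ) := by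
        exact_mod_cast (card_le_card hsub).trans card_biUnion_le
    _ ≤ ∑ _q : I × I, η * Fintype.card (κ → Ω) := sum_le_sum fun q _ => hpair q
    _ = Fintype.card I ^ 2 * η * Fintype.card (κ → Ω) := by
        rw [sum_const, card_univ, Fintype.card_prod, nsmul_eq_mul]
        push_cast
        ring

end RandomChoice

theorem FewClashes.exists_forall_not_clash {κ Ω V I : Type*} [Finite κ] [DecidableEq κ] [Fintype Ω]
    [Nonempty Ω] [Fintype I] {G : SimpleGraph V} {N : ℕ} {η : ℝ} {u : I → (κ → Ω) → V} {c : I → κ}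
    {R : I → I → Prop} (hG : FewClashes G N η) (hη : 0 ≤ η) (hN : N ≤ Fintype.card Ω)
    (hI : Fintype.card I ^ 2 * η < 1)
    (hu : ∀ p q, R p q → DrivenApart (u p) (u q) (c p) (c q)) :
    ∃ ω, ∀ p q, R p q → ¬ Clash G (u p ω) (u q ω) := by
  cases nonempty_fintype κ
  by_contra! hcon
  have hle := hG.card_exists_clash_le hη hN hu
  rw [filter_true_of_mem fun ω _ => hcon ω, card_univ] at hle
  have hpos : (0 : ℝ) < Fintype.card (κ → Ω) := Nat.cast_pos.2 Fintype.card_pos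
  exact (mul_lt_of_lt_one_left hpos hI).not_ge hle

section KovariSosTuran

theorem sum_choose_card_filter {α β : Type*} (R : α → β → Prop) (A : Finset α) (B : Finset β)
    (s : ℕ) :
    ∑ u ∈ A, (#{v ∈ B | R u v}).choose s = ∑ S ∈ B.powersetCard s, #{u ∈ A | ∀ v ∈ S, R u v} := by
  have key (u : α) : (#{v ∈ B | R u v}).choose s =
      #(bipartiteAbove (fun u (S : Finset β) => ∀ v ∈ S, R u v) (B.powersetCard s) u) := by
    rw [← card_powersetCard]
    congr 1
    ext S
    simp only [mem_powersetCard, mem_bipartiteAbove, subset_iff, mem_filter]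
    grind
  simp only [key]
  exact sum_card_bipartiteAbove_eq_sum_card_bipartiteBelow _

theorem sum_sub_pow_le_of_free {V : Type*} {G : SimpleGraph V} {s : ℕ}
    (hG : (completeBipartiteGraph (Fin s) (Fin s)).Free G) (A B : Finset V) :
    ∑ u ∈ A, ((#{v ∈ B | G.Adj u v} - s : ℕ) : ℝ) ^ s ≤ s * (#B : ℝ) ^ s := by
  have hcommon : ∀ S ∈ B.powersetCard s, #{u ∈ A | ∀ v ∈ S, G.Adj u v} ≤ s := by
    intro S hS
    by_contra! hlt
    obtain ⟨Q, hQ, hQs⟩ := exists_subset_card_eq hlt.le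
    refine hG (SimpleGraph.completeBipartiteGraph_isContained_iff.2 ⟨Q, S, ?_, ?_, ?_⟩)
    · rw [hQs, Fintype.card_fin]
    · rw [(mem_powersetCard.1 hS).2, Fintype.card_fin]
    · exact fun u hu v hv => (mem_filter.1 (hQ hu)).2 v hv
  have hchoose : ∑ u ∈ A, ((#{v ∈ B | G.Adj u v}).choose s : ℝ) ≤ s * (#B).choose s := by
    rw [← Nat.cast_sum, sum_choose_card_filter, mul_comm]
    have := sum_le_card_nsmul _ _ _ hcommon
    rw [card_powersetCard, smul_eq_mul] at this
    exact_mod_cast this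
  have hfac : (0 : ℝ) < s.factorial := Nat.cast_pos.2 s.factorial_pos
  calc ∑ u ∈ A, ((#{v ∈ B | G.Adj u v} - s : ℕ) : ℝ) ^ s
      ≤ ∑ u ∈ A, s.factorial * ((#{v ∈ B | G.Adj u v}).choose s : ℝ) := by
        refine sum_le_sum fun u _ => ?_
        rw [← div_le_iff₀' hfac]
        refine le_trans ?_ (Nat.pow_le_choose s _)
        gcongr
        omega
    _ ≤ s.factorial * (s * (#B).choose s) := by
        rw [← mul_sum]
        gcongr
    _ ≤ s.factorial * (s * ((#B : ℝ) ^ s / s.factorial)) := by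
        gcongr
        exact Nat.choose_le_pow_div s _
    _ = s * (#B : ℝ) ^ s := by field_simp

theorem card_filter_clash_le {V : Type*} (G : SimpleGraph V) (A B : Finset V) :
    #{q ∈ A ×ˢ B | Clash G q.1 q.2} ≤ ∑ u ∈ A, (#{v ∈ B | G.Adj u v} + 1) := by
  rw [card_filter, sum_product]
  refine sum_le_sum fun u _ => ?_
  rw [← card_filter]
  calc #{v ∈ B | Clash G u v} ≤ #(insert u {v ∈ B | G.Adj u v}) := by
        refine card_le_card fun v hv => ?_
        rw [mem_filter] at hv
        rcases hv with ⟨hvB, rfl | hadj⟩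
        · exact mem_insert_self _ _
        · exact mem_insert_of_mem (mem_filter.2 ⟨hvB, hadj⟩)
    _ ≤ #{v ∈ B | G.Adj u v} + 1 := card_insert_le _ _

theorem half_mul_card_lt_sum_sub {V : Type*} {G : SimpleGraph V} {A B : Finset V} {s : ℕ} {η : ℝ}
    (hA : A.Nonempty) (hB : 2 * (s + 1) < #B * η)
    (hmany : η * #A * #B < #{q ∈ A ×ˢ B | Clash G q.1 q.2}) :
    η / 2 * #A * #B < ∑ u ∈ A, ((#{v ∈ B | G.Adj u v} - s : ℕ) : ℝ) := by
  have hA₀ : (0 : ℝ) < #A := Nat.cast_pos.2 hA.card_pos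
  have hle : (#{q ∈ A ×ˢ B | Clash G q.1 q.2} : ℝ) ≤
      ∑ u ∈ A, (((#{v ∈ B | G.Adj u v} - s : ℕ) : ℝ) + (s + 1)) := by
    have (u : V) : #{v ∈ B | G.Adj u v} + 1 ≤ #{v ∈ B | G.Adj u v} - s + (s + 1) := by omega
    exact_mod_cast (card_filter_clash_le G A B).trans (sum_le_sum fun u _ => this u)
  rw [sum_add_distrib, sum_const, nsmul_eq_mul] at hle
  linarith [mul_lt_mul_of_pos_right hB hA₀]

theorem exists_fewClashes_of_free (s : ℕ) {η : ℝ} (hη : 0 < η) :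
    ∃ N : ℕ, 0 < N ∧ ∀ {V : Type*} (G : SimpleGraph V),
      (completeBipartiteGraph (Fin s) (Fin s)).Free G → FewClashes G N η := by
  obtain ⟨N, hN⟩ := exists_nat_gt (max (2 * (s + 1) / η) (s / (η / 2) ^ s))
  obtain ⟨hN₁, hN₂⟩ := max_lt_iff.1 hN
  have hN₀ : 0 < N := Nat.cast_pos.1 (lt_trans (by positivity) hN₁)
  refine ⟨N, hN₀, fun {V} G hfree A B hA hB => ?_⟩
  have hNA : (N : ℝ) ≤ #A := Nat.cast_le.2 hA
  have hNB : (N : ℝ) ≤ #B := Nat.cast_le.2 hB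
  have hA₀ : 0 < #A := hN₀.trans_le hA
  have hB₀ : 0 < #B := hN₀.trans_le hB
  by_contra! hmany
  have hexcess := half_mul_card_lt_sum_sub (card_pos.1 hA₀)
    ((div_lt_iff₀ hη).1 (hN₁.trans_le hNB)) hmany
  have hpowers := sum_sub_pow_le_of_free hfree A B
  rcases s with _ | k
  · simp only [pow_zero, sum_const, nsmul_eq_mul, mul_one, Nat.cast_zero] at hpowers
    exact hpowers.not_gt (Nat.cast_pos.2 hA₀)
  have hpow : (η / 2 * #A * #B) ^ (k + 1) ≤ (#A : ℝ) ^ k * ((k + 1 : ℕ) * (#B : ℝ) ^ (k + 1)) :=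
    calc (η / 2 * #A * #B) ^ (k + 1)
        ≤ (∑ u ∈ A, ((#{v ∈ B | G.Adj u v} - (k + 1) : ℕ) : ℝ)) ^ (k + 1) := by gcongr
      _ ≤ (#A : ℝ) ^ k * ∑ u ∈ A, ((#{v ∈ B | G.Adj u v} - (k + 1) : ℕ) : ℝ) ^ (k + 1) :=
        pow_sum_le_card_mul_sum_pow (fun _ _ => Nat.cast_nonneg _) k
      _ ≤ (#A : ℝ) ^ k * ((k + 1 : ℕ) * (#B : ℝ) ^ (k + 1)) := by gcongr
  have hlt : (#A : ℝ) ^ k * (#B : ℝ) ^ (k + 1) * (k + 1 : ℕ) <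
      (#A : ℝ) ^ k * (#B : ℝ) ^ (k + 1) * (#A * (η / 2) ^ (k + 1)) := by
    gcongr
    exact (div_lt_iff₀ (by positivity)).1 (hN₂.trans_le hNA)
  refine hlt.not_ge (le_of_eq_of_le ?_ (hpow.trans_eq ?_)) <;> ring

end KovariSosTuran

section Model

theorem leaf_mem_leaves {r t : ℕ} (p : Fin r × Fin t) :
    .inr (.inr p) ∈ leaves (heightTwoTree r t) := by
  refine ⟨.inr (.inl p.1), by simp [heightTwoTree], ?_⟩
  rintro (_ | i | q) h <;> simp_all [heightTwoTree]

theorem centre_notMem_leaves {r t : ℕ} (hr : 2 ≤ r) : .inl () ∉ leaves (heightTwoTree r t) := by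
  intro h
  have := h.unique (y₁ := .inr (.inl ⟨0, by omega⟩)) (y₂ := .inr (.inl ⟨1, by omega⟩))
    (by simp [heightTwoTree]) (by simp [heightTwoTree])
  simp at this

theorem middle_notMem_leaves {r t : ℕ} (ht : 1 ≤ t) (i : Fin r) :
    .inr (.inl i) ∉ leaves (heightTwoTree r t) := by
  intro h
  have := h.unique (y₁ := .inl ()) (y₂ := .inr (.inr (i, ⟨0, ht⟩)))
    (by simp [heightTwoTree]) (by simp [heightTwoTree])
  simp at this

/-- The vertices of `F^ℓ_{r,t}`: the shared leaves, and the centres and the middle vertices of the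
`ℓ` copies of `T_{r,t}`. -/
inductive PowerVertex (r t ℓ : ℕ) : Type
  | leaf (i : Fin r) (j : Fin t)
  | centre (a : Fin ℓ)
  | middle (a : Fin ℓ) (i : Fin r)

noncomputable instance PowerVertex.fintype (r t ℓ : ℕ) : Fintype (PowerVertex r t ℓ) :=
  .ofSurjective (fun v : Fin r × Fin t ⊕ Fin ℓ ⊕ Fin ℓ × Fin r => match v with
    | .inl (i, j) => .leaf i j
    | .inr (.inl a) => .centre a
    | .inr (.inr (a, i)) => .middle a i) <| by
  rintro (⟨i, j⟩ | a | ⟨a, i⟩)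
  · exact ⟨.inl (i, j), rfl⟩
  · exact ⟨.inr (.inl a), rfl⟩
  · exact ⟨.inr (.inr (a, i)), rfl⟩

/-- The graph `F^ℓ_{r,t}` on `PowerVertex r t ℓ`. Unlike `heightTwoPower`, it does not refer to the
leaves of the tree as a set of vertices of degree one. -/
def powerGraph (r t ℓ : ℕ) : SimpleGraph (PowerVertex r t ℓ) where
  Adj
    | .leaf i _, .middle _ k => i = k
    | .middle _ k, .leaf i _ => i = k
    | .centre a, .middle b _ => a = b
    | .middle b _, .centre a => a = b
    | _, _ => False
  symm := ⟨by rintro (_ | _ | _) (_ | _ | _) h <;> exact h⟩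
  loopless := ⟨by rintro (_ | _ | _) h <;> exact h⟩

variable {r t ℓ : ℕ}

theorem exists_powerGraph_iso (hr : 2 ≤ r) (ht : 1 ≤ t) :
    Nonempty (powerGraph r t ℓ ≃g heightTwoPower r t ℓ) := by
  let f : PowerVertex r t ℓ → leaves (heightTwoTree r t) ⊕ Fin ℓ × ↥(leaves (heightTwoTree r t))ᶜ
    | .leaf i j => .inl ⟨.inr (.inr (i, j)), leaf_mem_leaves _⟩
    | .centre a => .inr (a, ⟨.inl (), centre_notMem_leaves hr⟩)
    | .middle a i => .inr (a, ⟨.inr (.inl i), middle_notMem_leaves ht i⟩)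
  have hf : Bijective f := by
    constructor
    · rintro (_ | _ | _) (_ | _ | _) h <;> simp_all [f]
    · rintro (⟨⟨⟩ | i | ⟨i, j⟩, hv⟩ | ⟨a, ⟨⟩ | i | p, hv⟩)
      · exact absurd hv (centre_notMem_leaves hr)
      · exact absurd hv (middle_notMem_leaves ht i)
      · exact ⟨.leaf i j, rfl⟩
      · exact ⟨.centre a, rfl⟩
      · exact ⟨.middle a i, rfl⟩
      · exact absurd (leaf_mem_leaves p) hv
  refine ⟨⟨Equiv.ofBijective f hf, ?_⟩⟩
  intro p q
  change (heightTwoPower r t ℓ).Adj (f p) (f q) ↔ _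
  rcases p with _ | _ | _ <;> rcases q with _ | _ | _ <;>
    simp [f, powerGraph, heightTwoPower, rootedPower, heightTwoTree, eq_comm]

theorem exists_embedding_of_not_clash {W V : Type*} {H : SimpleGraph W} {G : SimpleGraph V}
    (f : W → V) (hadj : ∀ p q, H.Adj p q → G.Adj (f p) (f q))
    (hclash : ∀ p q, p ≠ q → ¬ H.Adj p q → ¬ Clash G (f p) (f q)) : ∃ e : H ↪g G, ⇑e = f := by
  refine ⟨⟨⟨f, fun p q hpq => ?_⟩, fun {p q} => ⟨fun h => ?_, hadj p q⟩⟩, rfl⟩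
  · by_contra hne
    exact hclash p q hne (fun h => (hadj p q h).ne hpq) (.inl hpq)
  · by_contra hpq
    exact hclash p q (fun hne => h.ne (congrArg f hne)) hpq (.inr h)

variable {α β : Type*} {G : SimpleGraph (α ⊕ β)}

/-- The placement of the vertices of `F^ℓ_{r,t}` in two parts `α` and `β`, with leaves `x` and
centres `z` in `α` and middle vertices `y` in `β`. -/
def placement (x : Fin r → Fin t → α) (z : Fin ℓ → α) (y : Fin ℓ → Fin r → β) :
    PowerVertex r t ℓ → α ⊕ β
  | .leaf i j => .inl (x i j)
  | .centre a => .inl (z a)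
  | .middle a i => .inr (y a i)

/-- `G` contains `F^ℓ_{r,t}` as an induced subgraph, with the leaves and the centres in `α` and the
middle vertices in `β`. -/
def HasPower (G : SimpleGraph (α ⊕ β)) (r t ℓ : ℕ) : Prop :=
  ∃ (e : powerGraph r t ℓ ↪g G) (x : Fin r → Fin t → α) (z : Fin ℓ → α) (y : Fin ℓ → Fin r → β),
    ⇑e = placement x z y

theorem HasPower.of_placement {x : Fin r → Fin t → α} {z : Fin ℓ → α} {y : Fin ℓ → Fin r → β}
    (hzy : ∀ a i, G.Adj (.inl (z a)) (.inr (y a i)))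
    (hxy : ∀ a i j, G.Adj (.inl (x i j)) (.inr (y a i)))
    (hclash : ∀ p q, p ≠ q → ¬ (powerGraph r t ℓ).Adj p q →
      ¬ Clash G (placement x z y p) (placement x z y q)) : HasPower G r t ℓ := by
  have hadj (p q) (h : (powerGraph r t ℓ).Adj p q) :
      G.Adj (placement x z y p) (placement x z y q) := by
    rcases p with ⟨i, j⟩ | a | ⟨a, i⟩ <;> rcases q with ⟨k, j'⟩ | b | ⟨b, k⟩ <;> try exact h.elim
    · obtain rfl : i = k := h
      exact hxy b i j
    · obtain rfl : a = b := h
      exact hzy a k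
    · obtain rfl : k = i := h
      exact (hxy a k j').symm
    · obtain rfl : b = a := h
      exact (hzy b i).symm
  obtain ⟨e, he⟩ := exists_embedding_of_not_clash (placement x z y) hadj hclash
  exact ⟨e, x, z, y, he⟩

theorem isLeft_placement_of_adj {x : Fin r → Fin t → α} {z : Fin ℓ → α} {y : Fin ℓ → Fin r → β}
    {p q : PowerVertex r t ℓ} (h : (powerGraph r t ℓ).Adj p q) :
    (placement x z y p).isLeft = !(placement x z y q).isLeft := by
  rcases p with _ | _ | _ <;> rcases q with _ | _ | _ <;> first | rfl | exact h.elim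

theorem HasPower.hasInducedCopyAcross {V : Type*} {G : SimpleGraph V} {X : Set V} {f : α → V}
    {g : β → V} (hr : 2 ≤ r) (ht : 1 ≤ t) (hfg : Injective (Sum.elim f g)) (hf : ∀ a, f a ∈ X)
    (hg : ∀ b, g b ∉ X) (h : HasPower (G.comap (Sum.elim f g)) r t ℓ) :
    HasInducedCopyAcross (heightTwoPower r t ℓ) G X := by
  obtain ⟨e, x, z, y, he⟩ := h
  obtain ⟨iso⟩ := exists_powerGraph_iso (ℓ := ℓ) hr ht
  have hside (v : α ⊕ β) : Sum.elim f g v ∈ X ↔ v.isLeft := by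
    rcases v with a | b <;> simp [hf, hg]
  let F := (SimpleGraph.Embedding.comap ⟨Sum.elim f g, hfg⟩ G).comp (e.comp iso.symm.toEmbedding)
  refine ⟨F, fun u v huv => SimpleGraph.between_adj.2 ⟨F.map_rel_iff.2 huv, ?_⟩⟩
  have hadj : (powerGraph r t ℓ).Adj (iso.symm u) (iso.symm v) := iso.symm.map_rel_iff.2 huv
  have hF (w) : F w ∈ X ↔ (placement x z y (iso.symm w)).isLeft := by
    rw [← hside, ← he]
    rfl
  simp only [Set.mem_compl_iff, hF, isLeft_placement_of_adj hadj]
  cases (placement x z y (iso.symm v)).isLeft <;> simp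

end Model

section LightTuples

variable {α β : Type*} {G : SimpleGraph (α ⊕ β)} {r t ℓ L : ℕ} {η : ℝ}

/-- The vertices in `β` that are joined to all entries of the tuple `g` of vertices of `α`. -/
noncomputable def commonNbrs [Fintype β] {τ : Type*} (G : SimpleGraph (α ⊕ β)) (g : τ → α) :
    Finset β :=
  {y | ∀ j, G.Adj (.inl (g j)) (.inr y)}

theorem mem_commonNbrs [Fintype β] {τ : Type*} {g : τ → α} {y : β} :
    y ∈ commonNbrs G g ↔ ∀ j, G.Adj (.inl (g j)) (.inr y) := by
  simp [commonNbrs]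

/-- A tuple of vertices is light if no two of its entries clash and it has fewer than `L` common
neighbours. -/
def Light [Fintype β] {τ : Type*} (G : SimpleGraph (α ⊕ β)) (L : ℕ) (g : τ → α) : Prop :=
  #(commonNbrs G g) < L ∧ ∀ j k, j ≠ k → ¬ Clash G (.inl (g j)) (.inl (g k))

theorem Light.injective [Fintype β] {τ : Type*} {g : τ → α} (hg : Light G L g) : Injective g := by
  intro j k hjk
  by_contra hne
  exact hg.2 j k hne (.inl (congrArg _ hjk))

/-- The random placement of `F^ℓ_{r,t}` in which every vertex has one coordinate: those of the
leaves and of the centres are indices for `e`, and that of a middle vertex is an index for the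
enumeration that `Y` assigns to the indices of its centre and of its leaves. -/
def sample (e : Fin L → α) (Y : (Fin (t + 1) → Fin L) → Fin L → α ⊕ β) :
    PowerVertex r t ℓ → (PowerVertex r t ℓ → Fin L) → α ⊕ β
  | .leaf i j, ω => .inl (e (ω (.leaf i j)))
  | .centre a, ω => .inl (e (ω (.centre a)))
  | .middle a i, ω => Y (Fin.cons (ω (.centre a)) fun j => ω (.leaf i j)) (ω (.middle a i))

variable {e : Fin L → α} {Y : (Fin (t + 1) → Fin L) → Fin L → α ⊕ β}

theorem sample_update_of_not_adj {p q : PowerVertex r t ℓ} (hne : p ≠ q)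
    (hadj : ¬ (powerGraph r t ℓ).Adj p q) (ω : PowerVertex r t ℓ → Fin L) (x : Fin L) :
    sample e Y p (update ω q x) = sample e Y p ω := by
  rcases p with ⟨i, j⟩ | a | ⟨a, i⟩
  · simp only [sample, update_of_ne hne]
  · simp only [sample, update_of_ne hne]
  · have hcentre : .centre a ≠ q := by
      rintro rfl
      exact hadj rfl
    have hleaf (j) : .leaf i j ≠ q := by
      rintro rfl
      exact hadj rfl
    simp only [sample, update_of_ne hne, update_of_ne hcentre, update_of_ne (hleaf _)]

theorem injective_sample_update (he : Injective e) (hY : ∀ h, Injective (Y h))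
    (p : PowerVertex r t ℓ) (ω : PowerVertex r t ℓ → Fin L) :
    Injective fun x => sample e Y p (update ω p x) := by
  rcases p with ⟨i, j⟩ | a | ⟨a, i⟩ <;> intro x x' hxx'
  · simpa [sample, he.eq_iff] using hxx'
  · simpa [sample, he.eq_iff] using hxx'
  · simpa [sample, (hY _).eq_iff] using hxx'

theorem drivenApart_sample (he : Injective e) (hY : ∀ h, Injective (Y h)) {p q : PowerVertex r t ℓ}
    (hne : p ≠ q) (hadj : ¬ (powerGraph r t ℓ).Adj p q) :
    DrivenApart (sample e Y p) (sample e Y q) p q where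
  ne := hne
  injective_left := injective_sample_update he hY p
  injective_right := injective_sample_update he hY q
  left_update := sample_update_of_not_adj hne hadj
  right_update := sample_update_of_not_adj hne.symm fun h => hadj h.symm

theorem exists_injective_enumeration (he : Injective e) (B : Finset β) :
    ∃ Y : Fin L → α ⊕ β, Injective Y ∧ (L ≤ #B → ∀ k, ∃ y ∈ B, Y k = .inr y) := by
  by_cases hB : L ≤ #B
  · obtain ⟨Q, hQ, hcard⟩ := exists_subset_card_eq hB
    let f := (Q.equivFinOfCardEq hcard).symm
    exact ⟨fun k => .inr (f k), Sum.inr_injective.comp (Subtype.val_injective.comp f.injective),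
      fun _ k => ⟨f k, hQ (f k).2, rfl⟩⟩
  · exact ⟨fun k => .inl (e k), Sum.inl_injective.comp he, fun h => absurd h hB⟩

variable [Fintype β]

theorem exists_light_comp_of_not_hasPower (hG : FewClashes G L η) (hη : 0 ≤ η)
    (hcard : Fintype.card (PowerVertex r t ℓ) ^ 2 * η < 1) (hL : 0 < L)
    (hpow : ¬ HasPower G r t ℓ) (he : Injective e) :
    ∃ h : Fin (t + 1) → Fin L, Light G L (e ∘ h) := by
  by_contra! hno
  have : Nonempty (Fin L) := ⟨⟨0, hL⟩⟩
  choose Y hYinj hY using fun h : Fin (t + 1) → Fin L =>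
    exists_injective_enumeration he (commonNbrs G (e ∘ h))
  obtain ⟨ω, hω⟩ := hG.exists_forall_not_clash hη (Fintype.card_fin L).ge hcard
    (R := fun p q => p ≠ q ∧ ¬ (powerGraph r t ℓ).Adj p q)
    fun _ _ hpq => drivenApart_sample he hYinj hpq.1 hpq.2
  have hheavy (a : Fin ℓ) (i : Fin r) : L ≤ #(commonNbrs G
      (e ∘ (Fin.cons (ω (.centre a)) fun j => ω (.leaf i j) : Fin (t + 1) → Fin L))) := by
    by_contra! hlt
    refine hno _ ⟨hlt, fun j k hjk => ?_⟩
    cases j using Fin.cases <;> cases k using Fin.cases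
    · exact absurd rfl hjk
    · exact hω (.centre a) (.leaf i _) ⟨by simp, id⟩
    · exact hω (.leaf i _) (.centre a) ⟨by simp, id⟩
    · exact hω (.leaf i _) (.leaf i _) ⟨by simpa using hjk, id⟩
  choose y hy hYy using fun a i => hY _ (hheavy a i) (ω (.middle a i))
  have hsample (p) : sample e Y p ω =
      placement (fun i j => e (ω (.leaf i j))) (fun a => e (ω (.centre a))) y p := by
    rcases p with _ | _ | ⟨a, i⟩
    exacts [rfl, rfl, hYy a i]
  have hyadj (a i) := mem_commonNbrs.1 (hy a i)
  refine hpow (.of_placement (x := fun i j => e (ω (.leaf i j))) (z := fun a => e (ω (.centre a)))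
    (fun a i => hyadj a i 0) (fun a i j => hyadj a i j.succ) fun p q hne hadj => ?_)
  rw [← hsample, ← hsample]
  exact hω p q ⟨hne, hadj⟩

end LightTuples

section Supersaturation

theorem card_filter_comp_mul {τ κ P : Type*} [Fintype τ] [DecidableEq τ] [Fintype κ]
    [DecidableEq κ] [Fintype P] {h : τ → κ} (hh : Injective h) (E : (τ → P) → Prop) :
    #{f : κ → P | E (f ∘ h)} * Fintype.card P ^ Fintype.card τ =
      #{g | E g} * Fintype.card P ^ Fintype.card κ := by
  have hleft : #{q : (κ → P) × (τ → P) | E (q.1 ∘ h)} =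
      #{f : κ → P | E (f ∘ h)} * Fintype.card P ^ Fintype.card τ := by
    rw [← Fintype.card_fun, ← card_univ, ← card_product]
    congr 1
    ext
    simp
  have hright : #{q : (κ → P) × (τ → P) | E q.2} =
      #{g | E g} * Fintype.card P ^ Fintype.card κ := by
    rw [← Fintype.card_fun, ← card_univ, mul_comm, ← card_product]
    congr 1
    ext
    simp
  have hextend (f : κ → P) (g : τ → P) : extend h (f ∘ h) (extend h g f) = f := by
    funext c
    by_cases hc : ∃ a, h a = c
    · obtain ⟨a, rfl⟩ := hc
      rw [hh.extend_apply, comp_apply]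
    · rw [extend_apply' _ _ _ hc, extend_apply' _ _ _ hc]
  rw [← hleft, ← hright]
  -- Exchange the values of `f` on the range of `h` with those of `g`.
  refine card_nbij' (fun q => (extend h q.2 q.1, q.1 ∘ h)) (fun q => (extend h q.2 q.1, q.1 ∘ h))
    ?_ ?_ ?_ ?_ <;> intro q <;> simp [hextend, extend_comp hh]

theorem pow_le_two_mul_descFactorial {L n : ℕ} (h : 2 * L ^ 2 ≤ n) :
    n ^ L ≤ 2 * n.descFactorial L := by
  rcases Nat.eq_zero_or_pos n with rfl | hn
  · obtain rfl : L = 0 := by simpa using h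
    simp
  have hn₀ : (0 : ℝ) < n := Nat.cast_pos.2 hn
  have hLn : L ≤ n := by nlinarith [Nat.le_self_pow two_ne_zero L]
  have hL : (L * (L / n) : ℝ) ≤ 1 / 2 := by
    rw [← mul_div_assoc, div_le_iff₀ hn₀]
    have : (2 * L ^ 2 : ℝ) ≤ n := by exact_mod_cast h
    linarith
  have hbernoulli : (1 / 2 : ℝ) ≤ (1 - L / n) ^ L := by
    have hdiv : (L / n : ℝ) ≤ 1 := (div_le_one hn₀).2 (Nat.cast_le.2 hLn)
    have := one_add_mul_le_pow (a := -(L / n : ℝ)) (by linarith) L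
    rw [← sub_eq_add_neg] at this
    linarith
  suffices (n : ℝ) ^ L ≤ 2 * n.descFactorial L by exact_mod_cast this
  calc (n : ℝ) ^ L = 2 * (n ^ L * (1 / 2)) := by ring
    _ ≤ 2 * (n ^ L * (1 - L / n) ^ L) := by gcongr
    _ = 2 * ((n - L : ℕ) : ℝ) ^ L := by
        rw [← mul_pow, mul_one_sub, mul_div_cancel₀ _ hn₀.ne', Nat.cast_sub hLn]
    _ ≤ 2 * n.descFactorial L := by
        have : (n - L) ^ L ≤ n.descFactorial L :=
          (Nat.pow_le_pow_left (by omega) L).trans (Nat.pow_sub_le_descFactorial n L)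
        gcongr
        exact_mod_cast this

theorem card_pow_le_of_forall_injective {τ κ P : Type*} [Fintype τ] [DecidableEq τ] [Fintype κ]
    [Fintype P] {E : (τ → P) → Prop} (hP : 2 * Fintype.card κ ^ 2 ≤ Fintype.card P)
    (hE : ∀ f : κ → P, Injective f → ∃ h : τ → κ, Injective h ∧ E (f ∘ h)) :
    Fintype.card P ^ Fintype.card τ ≤
      2 * Fintype.card κ ^ Fintype.card τ * #{g | E g} := by
  have hpos : 0 < Fintype.card P ^ Fintype.card κ := by
    refine Nat.pos_of_ne_zero fun h => ?_
    obtain ⟨hP₀, hκ⟩ := pow_eq_zero_iff'.1 h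
    exact hκ (by simpa [hP₀] using hP)
  have hcover : Fintype.card (κ ↪ P) ≤ ∑ h : τ → κ with Injective h, #{f : κ → P | E (f ∘ h)} := by
    refine le_trans ?_ card_biUnion_le
    rw [← card_univ]
    refine card_le_card_of_injOn (⇑) (fun f _ => ?_) (DFunLike.coe_injective.injOn)
    obtain ⟨h, hinj, hE⟩ := hE f f.injective
    exact mem_biUnion.2 ⟨h, by simpa using hinj, by simpa using hE⟩
  have hcomp : ∀ h ∈ ({h : τ → κ | Injective h} : Finset _),
      #{f : κ → P | E (f ∘ h)} * Fintype.card P ^ Fintype.card τ ≤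
        #{g | E g} * Fintype.card P ^ Fintype.card κ :=
    fun h hh => (card_filter_comp_mul (mem_filter.1 hh).2 E).le
  refine Nat.le_of_mul_le_mul_right ?_ hpos
  calc Fintype.card P ^ Fintype.card τ * Fintype.card P ^ Fintype.card κ
      ≤ Fintype.card P ^ Fintype.card τ *
          (2 * ∑ h : τ → κ with Injective h, #{f : κ → P | E (f ∘ h)}) := by
        gcongr
        refine (pow_le_two_mul_descFactorial hP).trans ?_
        rw [← Fintype.card_embedding_eq]
        gcongr
    _ = 2 * ∑ h : τ → κ with Injective h,
          #{f : κ → P | E (f ∘ h)} * Fintype.card P ^ Fintype.card τ := by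
        rw [← sum_mul]
        ring
    _ ≤ 2 * (Fintype.card κ ^ Fintype.card τ *
          (#{g | E g} * Fintype.card P ^ Fintype.card κ)) := by
        gcongr
        refine (sum_le_card_nsmul _ _ _ hcomp).trans ?_
        rw [smul_eq_mul, ← Fintype.card_fun (α := τ) (β := κ)]
        exact Nat.mul_le_mul_right _ (card_le_univ _)
    _ = 2 * Fintype.card κ ^ Fintype.card τ * #{g | E g} * Fintype.card P ^ Fintype.card κ := by
        ring

variable {α β : Type*} [Fintype β] {G : SimpleGraph (α ⊕ β)} {r t ℓ L : ℕ} {η : ℝ}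

/-- The light tuples of length `t` with all entries in `P`. -/
noncomputable def lightTuples (G : SimpleGraph (α ⊕ β)) (t L : ℕ) (P : Finset α) :
    Finset (Fin t → α) :=
  {g ∈ Fintype.piFinset fun _ => P | Light G L g}

/-- In every set of at least `m` vertices of `α`, at least a proportion `c` of the `(t + 1)`-tuples
is light. -/
def LightTuplesDense (G : SimpleGraph (α ⊕ β)) (t L m : ℕ) (c : ℝ) : Prop :=
  ∀ P : Finset α, m ≤ #P → c * (#P : ℝ) ^ (t + 1) ≤ #(lightTuples G (t + 1) L P)

theorem lightTuplesDense_of_not_hasPower (hG : FewClashes G L η) (hη : 0 ≤ η)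
    (hcard : Fintype.card (PowerVertex r t ℓ) ^ 2 * η < 1) (hL : 0 < L)
    (hpow : ¬ HasPower G r t ℓ) :
    LightTuplesDense G t L (2 * L ^ 2) (1 / (2 * L ^ (t + 1))) := by
  intro P hP
  have key : Fintype.card P ^ Fintype.card (Fin (t + 1)) ≤
      2 * Fintype.card (Fin L) ^ Fintype.card (Fin (t + 1)) *
        #{g : Fin (t + 1) → P | Light G L (Subtype.val ∘ g)} := by
    refine card_pow_le_of_forall_injective (by simpa using hP) fun f hf => ?_
    obtain ⟨h, hh⟩ := exists_light_comp_of_not_hasPower hG hη hcard hL hpow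
      (Subtype.val_injective.comp hf)
    exact ⟨h, hh.injective.of_comp, hh⟩
  have hle : #{g : Fin (t + 1) → P | Light G L (Subtype.val ∘ g)} ≤
      #(lightTuples G (t + 1) L P) := by
    refine card_le_card_of_injOn (Subtype.val ∘ ·) (fun g hg => ?_)
      (Subtype.val_injective.comp_left.injOn)
    exact mem_filter.2 ⟨Fintype.mem_piFinset.2 fun j => (g j).2, (mem_filter.1 hg).2⟩
  simp only [Fintype.card_coe, Fintype.card_fin] at key
  rw [one_div, inv_mul_le_iff₀ (by positivity)]
  exact_mod_cast key.trans (Nat.mul_le_mul_left _ hle)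

end Supersaturation

theorem mul_pow_le_sum_pow {ι : Type*} {A : Finset ι} {f : ι → ℝ} {M d : ℝ} (hf : ∀ a ∈ A, 0 ≤ f a)
    (hA : #A ≤ M) (hd : 0 ≤ d) (h : M * d ≤ ∑ a ∈ A, f a) {k : ℕ} (hk : k ≠ 0) :
    M * d ^ k ≤ ∑ a ∈ A, f a ^ k := by
  obtain ⟨k, rfl⟩ := Nat.exists_eq_succ_of_ne_zero hk
  have hM : 0 ≤ M := (Nat.cast_nonneg _).trans hA
  have hsum : 0 ≤ ∑ a ∈ A, f a ^ (k + 1) := sum_nonneg fun a ha => pow_nonneg (hf a ha) _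
  rcases hM.eq_or_lt with rfl | hM
  · simpa using hsum
  refine le_of_mul_le_mul_left ?_ (pow_pos hM k)
  calc M ^ k * (M * d ^ (k + 1)) = (M * d) ^ (k + 1) := by ring
    _ ≤ (∑ a ∈ A, f a) ^ (k + 1) := by gcongr
    _ ≤ (#A : ℝ) ^ k * ∑ a ∈ A, f a ^ (k + 1) := pow_sum_le_card_mul_sum_pow hf k
    _ ≤ M ^ k * ∑ a ∈ A, f a ^ (k + 1) := by gcongr

section AlmostRegular

variable {α β : Type*} [Fintype α] [Fintype β]

/-- The neighbours in `α` of a vertex of `β`. -/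
noncomputable def leftNbrs (G : SimpleGraph (α ⊕ β)) (b : β) : Finset α :=
  {a | G.Adj (.inl a) (.inr b)}

/-- The neighbours in `β` of a vertex of `α`. -/
noncomputable def rightNbrs (G : SimpleGraph (α ⊕ β)) (a : α) : Finset β :=
  {b | G.Adj (.inl a) (.inr b)}

theorem sum_card_leftNbrs_eq (G : SimpleGraph (α ⊕ β)) :
    ∑ b, #(leftNbrs G b) = ∑ a, #(rightNbrs G a) := by
  simp only [leftNbrs, rightNbrs, card_filter]
  exact sum_comm

/-- The edges of `G` between `α` and `β` are almost regular: the parts have at most `n` vertices,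
the degrees are at most `Δ`, and there are at least `n * Δ / K` edges. -/
structure AlmostRegular (G : SimpleGraph (α ⊕ β)) (n Δ K : ℕ) : Prop where
  card_left : Fintype.card α ≤ n
  card_right : Fintype.card β ≤ n
  card_leftNbrs_le b : #(leftNbrs G b) ≤ Δ
  card_rightNbrs_le a : #(rightNbrs G a) ≤ Δ
  le_mul_sum : n * Δ ≤ K * ∑ b, #(leftNbrs G b)

variable {G : SimpleGraph (α ⊕ β)} {n Δ K : ℕ}

theorem AlmostRegular.le_mul_card_right (hG : AlmostRegular G n Δ K) (hΔ : 0 < Δ) :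
    n ≤ K * Fintype.card β := by
  refine Nat.le_of_mul_le_mul_right ?_ hΔ
  rw [mul_assoc]
  exact hG.le_mul_sum.trans
    (Nat.mul_le_mul_left _ (sum_le_card_nsmul _ _ _ fun b _ => hG.card_leftNbrs_le b))

theorem AlmostRegular.le_mul_card_left (hG : AlmostRegular G n Δ K) (hΔ : 0 < Δ) :
    n ≤ K * Fintype.card α := by
  refine Nat.le_of_mul_le_mul_right ?_ hΔ
  rw [mul_assoc]
  refine hG.le_mul_sum.trans (Nat.mul_le_mul_left _ ?_)
  rw [sum_card_leftNbrs_eq]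
  exact sum_le_card_nsmul _ _ _ fun a _ => hG.card_rightNbrs_le a

theorem AlmostRegular.degree_le_mul (hG : AlmostRegular G n Δ K) (hn : 0 < n) : Δ ≤ K * n := by
  have hsum : ∑ b, #(leftNbrs G b) ≤ n * n :=
    (sum_le_card_nsmul _ _ _ fun b _ => (card_le_univ _).trans hG.card_left).trans
      (Nat.mul_le_mul_right _ hG.card_right)
  refine Nat.le_of_mul_le_mul_left ?_ hn
  calc n * Δ ≤ K * (n * n) := hG.le_mul_sum.trans (Nat.mul_le_mul_left _ hsum)
    _ = n * (K * n) := by ring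

theorem sum_card_leftNbrs_le_of_fewClashes {N : ℕ} {η : ℝ} (hclash : FewClashes G N η)
    (hα : N ≤ Fintype.card α) (hβ : N ≤ Fintype.card β) :
    (∑ b, #(leftNbrs G b) : ℝ) ≤ η * Fintype.card α * Fintype.card β := by
  have key := hclash (univ.image .inl) (univ.image .inr)
    (by rwa [card_image_of_injective _ Sum.inl_injective, card_univ])
    (by rwa [card_image_of_injective _ Sum.inr_injective, card_univ])
  rw [card_image_of_injective _ Sum.inl_injective, card_image_of_injective _ Sum.inr_injective,
    card_univ, card_univ] at key
  refine le_trans ?_ key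
  rw [← Nat.cast_sum, Nat.cast_le, ← card_sigma]
  refine card_le_card_of_injOn (fun q => (.inl q.2, .inr q.1)) (fun q hq => ?_) ?_
  · have hadj := (mem_filter.1 (mem_sigma.1 hq).2).2
    simpa using (show Clash G _ _ from .inr hadj)
  · rintro ⟨b, a⟩ - ⟨b', a'⟩ - h
    simpa [and_comm] using h

theorem AlmostRegular.degree_le_card {N : ℕ} (hG : AlmostRegular G n Δ K) (hn : 0 < n) (hK : 0 < K)
    (hclash : FewClashes G N (1 / K ^ 2)) (hΔ : K ^ 2 * N < Δ) :
    Δ ≤ Fintype.card α ∧ Δ ≤ Fintype.card β := by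
  have hΔ₀ : 0 < Δ := by omega
  have hlarge {c : ℕ} (hc : n ≤ K * c) : N ≤ c := by
    refine Nat.le_of_mul_le_mul_left ?_ (pow_pos hK 2)
    calc K ^ 2 * N ≤ K * n := hΔ.le.trans (hG.degree_le_mul hn)
      _ ≤ K * (K * c) := Nat.mul_le_mul_left _ hc
      _ = K ^ 2 * c := by ring
  have hsum := sum_card_leftNbrs_le_of_fewClashes hclash (hlarge (hG.le_mul_card_left hΔ₀))
    (hlarge (hG.le_mul_card_right hΔ₀))
  rw [mul_assoc, one_div, le_inv_mul_iff₀ (by positivity)] at hsum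
  have hprod : n * Δ ≤ Fintype.card α * Fintype.card β :=
    calc n * Δ ≤ K * ∑ b, #(leftNbrs G b) := hG.le_mul_sum
      _ ≤ K ^ 2 * ∑ b, #(leftNbrs G b) := Nat.mul_le_mul_right _ (Nat.le_self_pow two_ne_zero K)
      _ ≤ Fintype.card α * Fintype.card β := by exact_mod_cast hsum
  constructor <;> refine Nat.le_of_mul_le_mul_left (hprod.trans ?_) hn
  · rw [mul_comm]
    exact Nat.mul_le_mul_right _ hG.card_right
  · exact Nat.mul_le_mul_right _ hG.card_left

theorem AlmostRegular.le_sum_filter {m : ℕ} (hG : AlmostRegular G n Δ K) (hΔ : 2 * K * m ≤ Δ) :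
    n * Δ ≤ 2 * K * ∑ b with m ≤ #(leftNbrs G b), #(leftNbrs G b) := by
  have hfew : ∑ b with ¬ m ≤ #(leftNbrs G b), #(leftNbrs G b) ≤ n * m := by
    refine (sum_le_card_nsmul _ _ m fun b hb => ?_).trans
      (Nat.mul_le_mul_right _ ((card_le_univ _).trans hG.card_right))
    exact (not_le.1 (mem_filter.1 hb).2).le
  have hle := hG.le_mul_sum
  rw [← sum_filter_add_sum_filter_not univ fun b => m ≤ #(leftNbrs G b)] at hle
  nlinarith

end AlmostRegular

section GoodCopies

variable {α β : Type*} {G : SimpleGraph (α ⊕ β)} {r t : ℕ}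

/-- A branch of a copy of `T_{r,t}`: its middle vertex and its `t` leaves. -/
abbrev Branch (α β : Type*) (t : ℕ) : Type _ := β × (Fin t → α)

/-- The vertices of a copy of `T_{r,t}`: a centre and `r` branches. -/
abbrev TreeCopy (α β : Type*) (r t : ℕ) : Type _ := α × (Fin r → Branch α β t)

/-- The middle vertices and the leaves of a family of branches: `(i, none)` stands for the middle
vertex of branch `i`, and `(i, some j)` for its `j`-th leaf. -/
def branchVertex (w : Fin r → Branch α β t) : Fin r × Option (Fin t) → α ⊕ β
  | (i, none) => .inr (w i).1
  | (i, some j) => .inl ((w i).2 j)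

section Decode

variable {Δ : ℕ}

/-- The branches given by indices for an enumeration `ν` of the possible middle vertices, and for
enumerations `μ y` of the possible leaves that go with a middle vertex `y`. -/
def decode (ν : Fin Δ → β) (μ : β → Fin Δ → α) (ω : Fin r × Option (Fin t) → Fin Δ) (i : Fin r) :
    Branch α β t :=
  (ν (ω (i, none)), fun j => μ (ν (ω (i, none))) (ω (i, some j)))

variable {ν : Fin Δ → β} {μ : β → Fin Δ → α}

theorem branchVertex_decode_update {p q : Fin r × Option (Fin t)} (hpq : p.1 ≠ q.1)
    (ω : Fin r × Option (Fin t) → Fin Δ) (x : Fin Δ) :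
    branchVertex (decode ν μ (update ω q x)) p = branchVertex (decode ν μ ω) p := by
  obtain ⟨i, o⟩ := p
  have hne (o') : (i, o') ≠ q := by
    rintro rfl
    exact hpq rfl
  rcases o with _ | j <;> simp only [branchVertex, decode, update_of_ne (hne _)]

theorem injective_branchVertex_decode_update (hν : Injective ν) (hμ : ∀ y, Injective (μ y))
    (p : Fin r × Option (Fin t)) (ω : Fin r × Option (Fin t) → Fin Δ) :
    Injective fun x => branchVertex (decode ν μ (update ω p x)) p := by
  rcases p with ⟨i, _ | j⟩ <;> intro x x' hxx'
  · simpa [branchVertex, decode, hν.eq_iff] using hxx'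
  · simpa [branchVertex, decode, (hμ _).eq_iff] using hxx'

theorem drivenApart_decode (hν : Injective ν) (hμ : ∀ y, Injective (μ y))
    {p q : Fin r × Option (Fin t)} (hpq : p.1 ≠ q.1) :
    DrivenApart (fun ω => branchVertex (decode ν μ ω) p)
      (fun ω => branchVertex (decode ν μ ω) q) p q where
  ne h := hpq (congrArg Prod.fst h)
  injective_left := injective_branchVertex_decode_update hν hμ p
  injective_right := injective_branchVertex_decode_update hν hμ q
  left_update := branchVertex_decode_update hpq
  right_update := branchVertex_decode_update hpq.symm

end Decode

theorem exists_injective_subset_range {γ : Type*} [Fintype γ] {N : ℕ} {Q : Finset γ} (hQ : #Q ≤ N)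
    (hN : N ≤ Fintype.card γ) : ∃ f : Fin N → γ, Injective f ∧ ∀ q ∈ Q, ∃ k, f k = q := by
  obtain ⟨R, hQR, -, hR⟩ := exists_subsuperset_card_eq (subset_univ Q) hQ (by rwa [card_univ])
  refine ⟨fun k => (R.equivFinOfCardEq hR).symm k,
    Subtype.val_injective.comp (Equiv.injective _), fun q hq => ?_⟩
  exact ⟨R.equivFinOfCardEq hR ⟨q, hQR hq⟩, by simp⟩

variable [Fintype α] [Fintype β] {n Δ K L : ℕ}

/-- The branches in `G` at the centre `z`. -/
noncomputable def branches (G : SimpleGraph (α ⊕ β)) (t : ℕ) (z : α) : Finset (Branch α β t) :=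
  {w | G.Adj (.inl z) (.inr w.1) ∧ ∀ j, G.Adj (.inl (w.2 j)) (.inr w.1)}

theorem mem_branches {z : α} {w : Branch α β t} :
    w ∈ branches G t z ↔ w.1 ∈ rightNbrs G z ∧ ∀ j, w.2 j ∈ leftNbrs G w.1 := by
  simp [branches, rightNbrs, leftNbrs]

theorem AlmostRegular.card_branches_le (hG : AlmostRegular G n Δ K) (t : ℕ) (z : α) :
    #(branches G t z) ≤ Δ ^ (t + 1) := by
  have hfibre : ∀ y ∈ rightNbrs G z, #{w ∈ branches G t z | w.1 = y} ≤ Δ ^ t := by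
    intro y _
    calc #{w ∈ branches G t z | w.1 = y}
        ≤ #(Fintype.piFinset fun _ : Fin t => leftNbrs G y) := by
          refine card_le_card_of_injOn Prod.snd (fun w hw => ?_) fun w hw w' hw' h => ?_
          · obtain ⟨hwz, rfl⟩ := mem_filter.1 hw
            exact Fintype.mem_piFinset.2 (mem_branches.1 hwz).2
          · exact Prod.ext ((mem_filter.1 hw).2.trans (mem_filter.1 hw').2.symm) h
      _ ≤ Δ ^ t := by
          rw [Fintype.card_piFinset_const]
          exact Nat.pow_le_pow_left (hG.card_leftNbrs_le y) t
  calc #(branches G t z) ≤ Δ ^ t * #(rightNbrs G z) :=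
        card_le_mul_card_image_of_maps_to (fun w hw => (mem_branches.1 hw).1) _ hfibre
    _ ≤ Δ ^ t * Δ := Nat.mul_le_mul_left _ (hG.card_rightNbrs_le z)
    _ = Δ ^ (t + 1) := (pow_succ _ _).symm

/-- The families of branches at `z` with a clash between two different branches. -/
noncomputable def clashingFamilies (G : SimpleGraph (α ⊕ β)) (r t : ℕ) (z : α) :
    Finset (Fin r → Branch α β t) :=
  {w | (∀ i, w i ∈ branches G t z) ∧
    ∃ p q, p.1 ≠ q.1 ∧ Clash G (branchVertex w p) (branchVertex w q)}

theorem AlmostRegular.card_clashingFamilies_le {N : ℕ} {η : ℝ} (hG : AlmostRegular G n Δ K)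
    (hclash : FewClashes G N η) (hη : 0 ≤ η) (hN : N ≤ Δ) (hα : Δ ≤ Fintype.card α)
    (hβ : Δ ≤ Fintype.card β) (z : α) :
    (#(clashingFamilies G r t z) : ℝ) ≤ (r * (t + 1)) ^ 2 * η * Δ ^ (r * (t + 1)) := by
  obtain ⟨ν, hνinj, hν⟩ := exists_injective_subset_range (hG.card_rightNbrs_le z) hβ
  choose μ hμinj hμ using fun y => exists_injective_subset_range (hG.card_leftNbrs_le y) hα
  have hdecode (w : Fin r → Branch α β t) (hw : ∀ i, w i ∈ branches G t z) :
      ∃ ω, decode ν μ ω = w := by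
    choose k hk using fun i => hν _ (mem_branches.1 (hw i)).1
    choose k' hk' using fun i j => hμ _ _ ((mem_branches.1 (hw i)).2 j)
    refine ⟨fun p => p.2.elim (k p.1) (k' p.1), funext fun i => ?_⟩
    simp [decode, hk, hk']
  have hapart (p q : Fin r × Option (Fin t)) (hpq : p.1 ≠ q.1) :=
    drivenApart_decode hνinj hμinj hpq
  have key := hclash.card_exists_clash_le (u := fun p ω => branchVertex (decode ν μ ω) p) (c := id)
    (R := fun p q => p.1 ≠ q.1) hη (hN.trans_eq (Fintype.card_fin Δ).symm) hapart
  calc (#(clashingFamilies G r t z) : ℝ)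
      ≤ #{ω | ∃ p q, p.1 ≠ q.1 ∧
          Clash G (branchVertex (decode ν μ ω) p) (branchVertex (decode ν μ ω) q)} := by
        refine Nat.cast_le.2 (card_le_card_of_surjOn (decode ν μ) fun w hw => ?_)
        obtain ⟨-, hw, hwclash⟩ := mem_filter.1 hw
        obtain ⟨ω, rfl⟩ := hdecode w hw
        exact ⟨ω, mem_coe.2 (mem_filter.2 ⟨mem_univ _, hwclash⟩), rfl⟩
    _ ≤ _ := key
    _ = (r * (t + 1)) ^ 2 * η * Δ ^ (r * (t + 1)) := by simp

/-- The branches at `z` whose leaves form a light tuple together with `z`. -/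
noncomputable def lightBranches (G : SimpleGraph (α ⊕ β)) (t L : ℕ) (z : α) :
    Finset (Branch α β t) :=
  {w ∈ branches G t z | Light G L (Fin.cons z w.2 : Fin (t + 1) → α)}

theorem sum_card_lightBranches_eq (G : SimpleGraph (α ⊕ β)) (t L : ℕ) :
    ∑ z, #(lightBranches G t L z) = ∑ b, #(lightTuples G (t + 1) L (leftNbrs G b)) := by
  rw [← card_sigma, ← card_sigma]
  refine card_nbij' (fun q => ⟨q.2.1, Fin.cons q.1 q.2.2⟩)
    (fun q => ⟨q.2 0, q.1, Fin.tail q.2⟩) ?_ ?_ ?_ ?_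
  · rintro ⟨z, y, x⟩
    simp +contextual [lightBranches, lightTuples, branches, leftNbrs, Fin.forall_fin_succ]
  · rintro ⟨y, g⟩
    simp +contextual [lightBranches, lightTuples, branches, leftNbrs, Fin.forall_fin_succ, Fin.tail]
  · rintro ⟨z, y, x⟩ -
    simp
  · rintro ⟨y, g⟩ -
    simp

theorem AlmostRegular.le_sum_card_lightBranches {m : ℕ} {c : ℝ} (hG : AlmostRegular G n Δ K)
    (hlight : LightTuplesDense G t L m c) (hc : 0 ≤ c) (hK : 0 < K) (hΔ : 2 * K * m ≤ Δ) :
    c / (2 * K) ^ (t + 1) * n * Δ ^ (t + 1) ≤ ∑ z, (#(lightBranches G t L z) : ℝ) := by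
  set B : Finset β := {b | m ≤ #(leftNbrs G b)}
  have hK₀ : (0 : ℝ) < 2 * K := by positivity
  have hpow : n * (Δ / (2 * K) : ℝ) ^ (t + 1) ≤ ∑ b ∈ B, (#(leftNbrs G b) : ℝ) ^ (t + 1) := by
    refine mul_pow_le_sum_pow (fun _ _ => Nat.cast_nonneg _) ?_ (by positivity) ?_ t.succ_ne_zero
    · exact_mod_cast (card_le_univ _).trans hG.card_right
    · rw [← mul_div_assoc, div_le_iff₀' hK₀]
      exact_mod_cast hG.le_sum_filter hΔ
  calc c / (2 * K) ^ (t + 1) * n * Δ ^ (t + 1)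
      = c * (n * (Δ / (2 * K) : ℝ) ^ (t + 1)) := by
        rw [div_pow]
        ring
    _ ≤ ∑ b ∈ B, c * (#(leftNbrs G b) : ℝ) ^ (t + 1) := by
        rw [← mul_sum]
        gcongr
    _ ≤ ∑ b ∈ B, (#(lightTuples G (t + 1) L (leftNbrs G b)) : ℝ) :=
        sum_le_sum fun b hb => hlight _ (mem_filter.1 hb).2
    _ ≤ ∑ b, (#(lightTuples G (t + 1) L (leftNbrs G b)) : ℝ) :=
        sum_le_univ_sum_of_nonneg fun _ => Nat.cast_nonneg _
    _ = ∑ z, (#(lightBranches G t L z) : ℝ) := by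
        exact_mod_cast (sum_card_lightBranches_eq G t L).symm

/-- The copies of `T_{r,t}` all of whose branches are light, and in which no two vertices on
different branches clash. -/
noncomputable def goodCopies (G : SimpleGraph (α ⊕ β)) (r t L : ℕ) : Finset (TreeCopy α β r t) :=
  {T | (∀ i, T.2 i ∈ lightBranches G t L T.1) ∧
    ∀ p q, p.1 ≠ q.1 → ¬ Clash G (branchVertex T.2 p) (branchVertex T.2 q)}

theorem sum_pow_card_lightBranches_le (G : SimpleGraph (α ⊕ β)) (r t L : ℕ) :
    ∑ z, #(lightBranches G t L z) ^ r ≤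
      #(goodCopies G r t L) + ∑ z, #(clashingFamilies G r t z) := by
  have hfamily (z : α) : #(lightBranches G t L z) ^ r ≤
      #{T ∈ goodCopies G r t L | T.1 = z} + #(clashingFamilies G r t z) := by
    rw [← Fintype.card_fin r, ← Fintype.card_piFinset_const, Fintype.card_fin]
    refine (card_le_card_of_injOn (fun w => (z, w)) (fun w hw => ?_)
      (Prod.mk_right_injective z).injOn).trans
      ((card_union_le _ ((clashingFamilies G r t z).image fun w => (z, w))).trans
        (Nat.add_le_add_left card_image_le _))
    have hw := Fintype.mem_piFinset.1 hw
    by_cases hclash : ∃ p q, p.1 ≠ q.1 ∧ Clash G (branchVertex w p) (branchVertex w q)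
    · refine mem_union_right _ (mem_image_of_mem _ (mem_filter.2 ⟨mem_univ _, ?_, hclash⟩))
      exact fun i => (mem_filter.1 (hw i)).1
    · refine mem_union_left _ (mem_filter.2 ⟨mem_filter.2 ⟨mem_univ _, hw, ?_⟩, rfl⟩)
      exact fun p q hpq h => hclash ⟨p, q, hpq, h⟩
  rw [card_eq_sum_card_fiberwise (f := Prod.fst) (t := univ) (by simp), ← sum_add_distrib]
  exact sum_le_sum fun z _ => hfamily z

theorem AlmostRegular.le_card_goodCopies {N : ℕ} {η c : ℝ} (hG : AlmostRegular G n Δ K)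
    (hclash : FewClashes G N η) (hη : 0 ≤ η) (hN : N ≤ Δ) (hα : Δ ≤ Fintype.card α)
    (hβ : Δ ≤ Fintype.card β) (hr : r ≠ 0) (hc : 0 ≤ c)
    (hsum : c * n * Δ ^ (t + 1) ≤ ∑ z, (#(lightBranches G t L z) : ℝ))
    (hηc : (r * (t + 1)) ^ 2 * η ≤ c ^ r / 2) :
    c ^ r / 2 * n * Δ ^ (r * (t + 1)) ≤ #(goodCopies G r t L) := by
  have hn : (Fintype.card α : ℝ) ≤ n := Nat.cast_le.2 hG.card_left
  have hlight : n * (c * Δ ^ (t + 1)) ^ r ≤ ∑ z, (#(lightBranches G t L z) : ℝ) ^ r :=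
    mul_pow_le_sum_pow (fun _ _ => Nat.cast_nonneg _) (by rwa [card_univ]) (by positivity)
      (hsum.trans_eq' (by ring)) hr
  have hbad : ∑ z, (#(clashingFamilies G r t z) : ℝ) ≤ n * (c ^ r / 2 * Δ ^ (r * (t + 1))) := by
    refine (sum_le_card_nsmul _ _ _ fun z _ =>
      (hG.card_clashingFamilies_le hclash hη hN hα hβ z).trans
        (mul_le_mul_of_nonneg_right hηc (by positivity))).trans ?_
    rw [nsmul_eq_mul, card_univ]
    gcongr
  have hsplit : ∑ z, (#(lightBranches G t L z) : ℝ) ^ r ≤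
      #(goodCopies G r t L) + ∑ z, (#(clashingFamilies G r t z) : ℝ) := by
    exact_mod_cast sum_pow_card_lightBranches_le G r t L
  rw [mul_pow, ← pow_mul, mul_comm (t + 1)] at hlight
  linarith

end GoodCopies

section Kernels

variable {α β : Type*} {r t N A : ℕ} {S : Finset (Fin r)} {T T' : TreeCopy α β r t}

/-- Two copies of `T_{r,t}` agree on the branches in `S` if they have the same leaves, on all
branches, and the same middle vertices on the branches in `S`. -/
def Agree (S : Finset (Fin r)) (T T' : TreeCopy α β r t) : Prop :=
  (∀ i, (T.2 i).2 = (T'.2 i).2) ∧ ∀ i ∈ S, (T.2 i).1 = (T'.2 i).1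

theorem Agree.symm (h : Agree S T T') : Agree S T' T :=
  ⟨fun i => (h.1 i).symm, fun i hi => (h.2 i hi).symm⟩

theorem Agree.trans {T'' : TreeCopy α β r t} (h : Agree S T T') (h' : Agree S T' T'') :
    Agree S T T'' :=
  ⟨fun i => (h.1 i).trans (h'.1 i), fun i hi => (h.2 i hi).trans (h'.2 i hi)⟩

theorem Agree.mono {S' : Finset (Fin r)} (h : Agree S T T') (hS : S' ⊆ S) : Agree S' T T' :=
  ⟨h.1, fun i hi => h.2 i (hS hi)⟩

/-- Two copies of `T_{r,t}` are separate outside `S` if they have different centres and no common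
middle vertices on the branches outside `S`. -/
def Separate (S : Finset (Fin r)) (T T' : TreeCopy α β r t) : Prop :=
  T.1 ≠ T'.1 ∧ ∀ i ∉ S, ∀ j ∉ S, (T.2 i).1 ≠ (T'.2 j).1

theorem Separate.symm (h : Separate S T T') : Separate S T' T :=
  ⟨h.1.symm, fun i hi j hj => (h.2 j hj i hi).symm⟩

/-- The leaves of `T` and its middle vertices on the branches in `S` are the kernel of a sunflower
with `N` petals in `𝒯`. -/
def IsKernel (𝒯 : Finset (TreeCopy α β r t)) (S : Finset (Fin r)) (N : ℕ)
    (T : TreeCopy α β r t) : Prop :=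
  ∃ 𝓕 ⊆ 𝒯, N ≤ #𝓕 ∧ (∀ T' ∈ 𝓕, Agree S T' T) ∧
    (𝓕 : Set (TreeCopy α β r t)).Pairwise (Separate S)

theorem IsKernel.mono {𝒯 𝒯' : Finset (TreeCopy α β r t)} (h : IsKernel 𝒯 S N T) (h𝒯 : 𝒯 ⊆ 𝒯') :
    IsKernel 𝒯' S N T :=
  let ⟨𝓕, h𝓕, hrest⟩ := h
  ⟨𝓕, h𝓕.trans h𝒯, hrest⟩

theorem IsKernel.of_agree {𝒯 : Finset (TreeCopy α β r t)} (h : IsKernel 𝒯 S N T)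
    (hT : Agree S T T') : IsKernel 𝒯 S N T' :=
  let ⟨𝓕, h𝓕, hcard, hagree, hsep⟩ := h
  ⟨𝓕, h𝓕, hcard, fun T'' hT'' => (hagree T'' hT'').trans hT, hsep⟩

theorem exists_maximal_pairwise {γ : Type*} {R : γ → γ → Prop} (hR : ∀ a b, R a b → R b a)
    (𝒮 : Finset γ) :
    ∃ 𝓕 ⊆ 𝒮, (𝓕 : Set γ).Pairwise R ∧ ∀ a ∈ 𝒮, a ∉ 𝓕 → ∃ b ∈ 𝓕, ¬ R a b := by
  obtain ⟨𝓕, h𝓕, hmax⟩ := exists_max_image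
    ({𝓕 ∈ 𝒮.powerset | (𝓕 : Set γ).Pairwise R} : Finset (Finset γ)) card ⟨∅, by simp⟩
  obtain ⟨hsub, hpair⟩ := mem_filter.1 h𝓕
  rw [mem_powerset] at hsub
  refine ⟨𝓕, hsub, hpair, fun a ha ha𝓕 => ?_⟩
  by_contra! hall
  have hle := hmax (insert a 𝓕) <| mem_filter.2
    ⟨mem_powerset.2 (insert_subset ha hsub), by
      rw [coe_insert]
      exact hpair.insert fun b hb _ => ⟨hall b hb, hR _ _ (hall b hb)⟩⟩
  rw [card_insert_of_notMem ha𝓕] at hle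
  omega

theorem card_not_separate_le {𝒮 : Finset (TreeCopy α β r t)} {B : ℕ}
    (hA : ∀ z, #{T ∈ 𝒮 | T.1 = z} ≤ A) (hB : ∀ i ∉ S, ∀ y, #{T ∈ 𝒮 | (T.2 i).1 = y} ≤ B)
    (T' : TreeCopy α β r t) : #{T ∈ 𝒮 | ¬ Separate S T T'} ≤ A + r ^ 2 * B := by
  have hsub : {T ∈ 𝒮 | ¬ Separate S T T'} ⊆ {T ∈ 𝒮 | T.1 = T'.1} ∪
      (Sᶜ ×ˢ Sᶜ).biUnion fun p => {T ∈ 𝒮 | (T.2 p.1).1 = (T'.2 p.2).1} := by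
    intro T hT
    obtain ⟨hT, hsep⟩ := mem_filter.1 hT
    by_cases hz : T.1 = T'.1
    · exact mem_union_left _ (mem_filter.2 ⟨hT, hz⟩)
    · obtain ⟨i, hi, j, hj, hij⟩ : ∃ i ∉ S, ∃ j ∉ S, (T.2 i).1 = (T'.2 j).1 := by
        by_contra! hne
        exact hsep ⟨hz, hne⟩
      refine mem_union_right _ (mem_biUnion.2 ⟨(i, j), ?_, mem_filter.2 ⟨hT, hij⟩⟩)
      exact mem_product.2 ⟨mem_compl.2 hi, mem_compl.2 hj⟩
  refine (card_le_card hsub).trans ((card_union_le _ _).trans (Nat.add_le_add (hA _) ?_))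
  refine (card_biUnion_le_card_mul _ _ B fun p hp => ?_).trans (Nat.mul_le_mul_right _ ?_)
  · exact hB _ (mem_compl.1 (mem_product.1 hp).1) _
  · have hS : #Sᶜ ≤ r := (card_le_univ _).trans_eq (Fintype.card_fin r)
    rw [card_product, sq]
    exact Nat.mul_le_mul hS hS

theorem isKernel_of_card_lt {𝒮 : Finset (TreeCopy α β r t)} {B : ℕ}
    (hA : ∀ z, #{T ∈ 𝒮 | T.1 = z} ≤ A) (hB : ∀ i ∉ S, ∀ y, #{T ∈ 𝒮 | (T.2 i).1 = y} ≤ B)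
    (hS : ∀ T ∈ 𝒮, ∀ T' ∈ 𝒮, Agree S T T') (hlt : N * (A + r ^ 2 * B) < #𝒮) (hT : T ∈ 𝒮) :
    IsKernel 𝒮 S N T := by
  obtain ⟨𝓕, h𝓕, hsep, hmax⟩ := exists_maximal_pairwise (fun _ _ => Separate.symm (S := S)) 𝒮
  refine ⟨𝓕, h𝓕, ?_, fun T' hT' => hS T' (h𝓕 hT') T hT, hsep⟩
  by_contra! hlt'
  have hcover : 𝒮 ⊆ 𝓕.biUnion fun T' => {T ∈ 𝒮 | ¬ Separate S T T'} := by
    intro T hT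
    by_cases hT𝓕 : T ∈ 𝓕
    · exact mem_biUnion.2 ⟨T, hT𝓕, mem_filter.2 ⟨hT, fun h => h.1 rfl⟩⟩
    · obtain ⟨T', hT', hTT'⟩ := hmax T hT hT𝓕
      exact mem_biUnion.2 ⟨T', hT', mem_filter.2 ⟨hT, hTT'⟩⟩
  refine hlt.not_ge ((card_le_card hcover).trans ?_)
  exact (card_biUnion_le_card_mul _ _ _ fun T' _ => card_not_separate_le hA hB T').trans
    (Nat.mul_le_mul_right _ hlt'.le)

/-- The number of copies of `T_{r,t}` with common leaves, at most `A` at each centre, that forces a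
sunflower with `N` petals if `k` of the middle vertices are not fixed. -/
def sunflowerBound (r N A : ℕ) : ℕ → ℕ
  | 0 => N * A
  | k + 1 => N * (A + r ^ 2 * sunflowerBound r N A k)

theorem exists_isKernel_of_sunflowerBound_lt (k : ℕ) {𝒮 : Finset (TreeCopy α β r t)}
    (hk : #Sᶜ = k) (hA : ∀ z, #{T ∈ 𝒮 | T.1 = z} ≤ A) (hS : ∀ T ∈ 𝒮, ∀ T' ∈ 𝒮, Agree S T T')
    (hlt : sunflowerBound r N A k < #𝒮) : ∃ S', ∃ T ∈ 𝒮, IsKernel 𝒮 S' N T := by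
  obtain ⟨T₀, hT₀⟩ := card_pos.1 (Nat.zero_le _ |>.trans_lt hlt)
  induction k generalizing 𝒮 S T₀ with
  | zero =>
    refine ⟨S, T₀, hT₀, isKernel_of_card_lt (B := 0) hA (fun i hi => ?_) hS hlt hT₀⟩
    exact absurd (mem_compl.2 hi) (by simp [card_eq_zero.1 hk])
  | succ k ih =>
    by_contra! hnot
    refine hnot S T₀ hT₀ (isKernel_of_card_lt hA (fun i hi y => ?_) hS hlt hT₀)
    by_contra! hy
    have hsub : {T ∈ 𝒮 | (T.2 i).1 = y} ⊆ 𝒮 := filter_subset _ _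
    obtain ⟨T₁, hT₁⟩ := card_pos.1 (Nat.zero_le _ |>.trans_lt hy)
    have hagree : ∀ T ∈ ({T ∈ 𝒮 | (T.2 i).1 = y} : Finset _),
        ∀ T' ∈ ({T ∈ 𝒮 | (T.2 i).1 = y} : Finset _), Agree (insert i S) T T' := by
      intro T hT T' hT'
      obtain ⟨hT, hTy⟩ := mem_filter.1 hT
      obtain ⟨hT', hTy'⟩ := mem_filter.1 hT'
      exact ⟨(hS T hT T' hT').1,
        (forall_mem_insert _ _ _).2 ⟨hTy.trans hTy'.symm, (hS T hT T' hT').2⟩⟩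
    obtain ⟨S', T, hT, hker⟩ := ih
      (by rw [compl_insert, card_erase_of_mem (mem_compl.2 hi), hk, Nat.add_sub_cancel])
      (fun z => (card_le_card (filter_subset_filter _ hsub)).trans (hA z)) hagree hy T₁ hT₁
    exact hnot S' T (hsub hT) (hker.mono hsub)

/-- The centre (`none`) and the middle vertices (`some i`) of a copy of `T_{r,t}`. -/
def coreVertex (T : TreeCopy α β r t) : Option (Fin r) → α ⊕ β
  | none => .inl T.1
  | some i => .inr (T.2 i).1

theorem injective_coreVertex {e : Fin N → TreeCopy α β r t} (he : Pairwise (Separate ∅ on e))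
    (o : Option (Fin r)) : Injective fun k => coreVertex (e k) o := by
  intro k k' h
  by_contra hne
  rcases o with _ | i
  · exact (he hne).1 (Sum.inl_injective h)
  · exact (he hne).2 i (notMem_empty i) i (notMem_empty i) (Sum.inr_injective h)

end Kernels

section GoodKernels

variable {α β : Type*} [Fintype α] [Fintype β] {G : SimpleGraph (α ⊕ β)} {r t L N ℓ : ℕ}
  {T : TreeCopy α β r t}

theorem mem_branches_of_mem_goodCopies (hT : T ∈ goodCopies G r t L) (i : Fin r) :
    T.2 i ∈ branches G t T.1 :=
  (mem_filter.1 ((mem_filter.1 hT).2.1 i)).1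

theorem light_of_mem_goodCopies (hT : T ∈ goodCopies G r t L) (i : Fin r) :
    Light G L (Fin.cons T.1 (T.2 i).2 : Fin (t + 1) → α) :=
  (mem_filter.1 ((mem_filter.1 hT).2.1 i)).2

theorem adj_centre_of_mem_goodCopies (hT : T ∈ goodCopies G r t L) (i : Fin r) :
    G.Adj (.inl T.1) (.inr (T.2 i).1) :=
  (mem_filter.1 (mem_branches_of_mem_goodCopies hT i)).2.1

theorem adj_leaf_of_mem_goodCopies (hT : T ∈ goodCopies G r t L) (i : Fin r) (j : Fin t) :
    G.Adj (.inl ((T.2 i).2 j)) (.inr (T.2 i).1) :=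
  (mem_filter.1 (mem_branches_of_mem_goodCopies hT i)).2.2 j

theorem mem_commonNbrs_of_mem_goodCopies (hT : T ∈ goodCopies G r t L) (i : Fin r) :
    (T.2 i).1 ∈ commonNbrs G (Fin.cons T.1 (T.2 i).2 : Fin (t + 1) → α) := by
  rw [mem_commonNbrs, Fin.forall_fin_succ]
  exact ⟨adj_centre_of_mem_goodCopies hT i, adj_leaf_of_mem_goodCopies hT i⟩

theorem not_clash_branchVertex_of_mem_goodCopies (hT : T ∈ goodCopies G r t L)
    {p q : Fin r × Option (Fin t)} (hpq : p.1 ≠ q.1) :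
    ¬ Clash G (branchVertex T.2 p) (branchVertex T.2 q) :=
  (mem_filter.1 hT).2.2 p q hpq

theorem not_clash_leaf_centre_of_mem_goodCopies (hT : T ∈ goodCopies G r t L) (i : Fin r)
    (j : Fin t) : ¬ Clash G (.inl ((T.2 i).2 j)) (.inl T.1) := by
  simpa using (light_of_mem_goodCopies hT i).2 j.succ 0 (Fin.succ_ne_zero j)

theorem not_clash_leaves_of_mem_goodCopies (hT : T ∈ goodCopies G r t L) {i i' : Fin r}
    {j j' : Fin t} (h : (i, j) ≠ (i', j')) :
    ¬ Clash G (.inl ((T.2 i).2 j)) (.inl ((T.2 i').2 j')) := by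
  by_cases hi : i = i'
  · subst hi
    simpa using (light_of_mem_goodCopies hT i).2 j.succ j'.succ
      (by simpa [Fin.succ_inj] using h)
  · exact not_clash_branchVertex_of_mem_goodCopies hT (p := (i, some j)) (q := (i', some j')) hi

theorem card_goodCopies_filter_le (z : α) (x : Fin r → Fin t → α) :
    #{T ∈ goodCopies G r t L | T.1 = z ∧ ∀ i, (T.2 i).2 = x i} ≤ L ^ r := by
  rcases eq_empty_or_nonempty {T ∈ goodCopies G r t L | T.1 = z ∧ ∀ i, (T.2 i).2 = x i} with h | h
  · simp [h]
  obtain ⟨T₀, h₀⟩ := h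
  obtain ⟨hT₀, rfl, hx⟩ := mem_filter.1 h₀
  obtain rfl : (fun i => (T₀.2 i).2) = x := funext hx
  let C (i : Fin r) : Finset β := commonNbrs G (Fin.cons T₀.1 (T₀.2 i).2 : Fin (t + 1) → α)
  calc _ ≤ #(Fintype.piFinset C) := by
        refine card_le_card_of_injOn (fun T i => (T.2 i).1) (fun T hT => ?_) fun T hT T' hT' h => ?_
        · obtain ⟨hT, hz, hx⟩ := mem_filter.1 hT
          refine Fintype.mem_piFinset.2 fun i => ?_
          simpa only [C, hz, hx] using mem_commonNbrs_of_mem_goodCopies hT i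
        · obtain ⟨-, hz, hx⟩ := mem_filter.1 hT
          obtain ⟨-, hz', hx'⟩ := mem_filter.1 hT'
          exact Prod.ext (hz.trans hz'.symm)
            (funext fun i => Prod.ext (congrFun h i) ((hx i).trans (hx' i).symm))
    _ ≤ L ^ r := by
        rw [Fintype.card_piFinset]
        refine (prod_le_pow_card _ _ L fun i _ => (light_of_mem_goodCopies hT₀ i).1.le).trans_eq ?_
        rw [card_univ, Fintype.card_fin]

theorem card_not_isKernel_le (N : ℕ) :
    #{T ∈ goodCopies G r t L | ∀ S, ¬ IsKernel (goodCopies G r t L) S N T} ≤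
      sunflowerBound r N (L ^ r) r * Fintype.card α ^ (r * t) := by
  set 𝒰 := {T ∈ goodCopies G r t L | ∀ S, ¬ IsKernel (goodCopies G r t L) S N T}
  have hfibre (x : Fin r → Fin t → α) :
      #{T ∈ 𝒰 | (fun i => (T.2 i).2) = x} ≤ sunflowerBound r N (L ^ r) r := by
    by_contra! hlt
    have hsub : {T ∈ 𝒰 | (fun i => (T.2 i).2) = x} ⊆ goodCopies G r t L :=
      (filter_subset _ _).trans (filter_subset _ _)
    have hleaf {T} (hT : T ∈ ({T ∈ 𝒰 | (fun i => (T.2 i).2) = x} : Finset _)) (i : Fin r) :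
        (T.2 i).2 = x i := congrFun (mem_filter.1 hT).2 i
    have hcentre (z : α) :
        #{T ∈ ({T ∈ 𝒰 | (fun i => (T.2 i).2) = x} : Finset _) | T.1 = z} ≤ L ^ r := by
      refine (card_le_card fun T hT => ?_).trans (card_goodCopies_filter_le (G := G) z x)
      obtain ⟨hT, hz⟩ := mem_filter.1 hT
      exact mem_filter.2 ⟨hsub hT, hz, hleaf hT⟩
    obtain ⟨S, T, hT, hker⟩ := exists_isKernel_of_sunflowerBound_lt (S := ∅) r (by simp) hcentre
      (fun T hT T' hT' => ⟨fun i => (hleaf hT i).trans (hleaf hT' i).symm, by simp⟩) hlt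
    exact (mem_filter.1 (mem_filter.1 hT).1).2 S (hker.mono hsub)
  refine (card_le_mul_card_image 𝒰 _ fun x _ => hfibre x).trans (Nat.mul_le_mul_left _ ?_)
  refine (card_le_univ _).trans_eq ?_
  simp only [Fintype.card_fun, Fintype.card_fin]
  rw [← pow_mul, mul_comm]

theorem HasPower.of_goodCopies {F : Fin ℓ → TreeCopy α β r t} (hF : ∀ a, F a ∈ goodCopies G r t L)
    (hT : T ∈ goodCopies G r t L) (hleaf : ∀ a i, ((F a).2 i).2 = (T.2 i).2)
    (hcore : ∀ a b, a ≠ b → ∀ o o', ¬ Clash G (coreVertex (F a) o) (coreVertex (F b) o')) :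
    HasPower G r t ℓ := by
  have hlm {a i k j} (hik : i ≠ k) : ¬ Clash G (.inl ((T.2 i).2 j)) (.inr ((F a).2 k).1) := by
    rw [← hleaf a]
    exact not_clash_branchVertex_of_mem_goodCopies (hF a) (p := (i, some j)) (q := (k, none)) hik
  have hlc {a i j} : ¬ Clash G (.inl ((T.2 i).2 j)) (.inl (F a).1) := by
    rw [← hleaf a]
    exact not_clash_leaf_centre_of_mem_goodCopies (hF a) i j
  refine HasPower.of_placement (x := fun i => (T.2 i).2) (z := fun a => (F a).1)
    (y := fun a i => ((F a).2 i).1) (fun a => adj_centre_of_mem_goodCopies (hF a))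
    (fun a i j => ?_) ?_
  · rw [← hleaf a]
    exact adj_leaf_of_mem_goodCopies (hF a) i j
  rintro (⟨i, j⟩ | a | ⟨a, i⟩) (⟨k, j'⟩ | b | ⟨b, k⟩) hne hadj
  · exact not_clash_leaves_of_mem_goodCopies hT fun h => hne (by simpa using h)
  · exact hlc
  · exact hlm hadj
  · exact fun h => hlc h.symm
  · exact hcore a b (fun h => hne (by rw [h])) none none
  · exact hcore a b hadj none (some k)
  · exact fun h => hlm hadj h.symm
  · exact hcore a b (Ne.symm hadj) (some i) none
  · by_cases hab : a = b
    · subst hab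
      exact not_clash_branchVertex_of_mem_goodCopies (hF a) (p := (i, none)) (q := (k, none))
        fun h => hne (by rw [show i = k from h])
    · exact hcore a b hab (some i) (some k)

theorem IsKernel.hasPower {M : ℕ} {η : ℝ} (hG : FewClashes G M η) (hη : 0 ≤ η)
    (hcard : (ℓ * (r + 1)) ^ 2 * η < 1) (hM : M ≤ N) (hN : 0 < N)
    (h : IsKernel (goodCopies G r t L) ∅ N T) : HasPower G r t ℓ := by
  obtain ⟨𝓕, h𝓕, hcard𝓕, hagree, hsep⟩ := h
  obtain ⟨Q, hQ, hQcard⟩ := exists_subset_card_eq hcard𝓕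
  let e (k : Fin N) : TreeCopy α β r t := (Q.equivFinOfCardEq hQcard).symm k
  have he (k) : e k ∈ 𝓕 := hQ ((Q.equivFinOfCardEq hQcard).symm k).2
  have hinj (o) : Injective fun k => coreVertex (e k) o :=
    injective_coreVertex (fun k k' hkk' => hsep (he k) (he k') fun h =>
      hkk' ((Q.equivFinOfCardEq hQcard).symm.injective (Subtype.ext h))) o
  have : Nonempty (Fin N) := ⟨⟨0, hN⟩⟩
  obtain ⟨ω, hω⟩ := hG.exists_forall_not_clash (κ := Fin ℓ) (Ω := Fin N)
    (I := Fin ℓ × Option (Fin r)) (c := Prod.fst) (R := fun p q => p.1 ≠ q.1)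
    (u := fun p ω => coreVertex (e (ω p.1)) p.2) hη (by simpa using hM) (by simpa using hcard)
    fun p q hpq => ⟨hpq, fun ω => by simpa using hinj p.2, fun ω => by simpa using hinj q.2,
      fun ω x => by simp [update_of_ne hpq], fun ω x => by simp [update_of_ne hpq.symm]⟩
  refine HasPower.of_goodCopies (F := fun a => e (ω a)) (T := e ⟨0, hN⟩) (fun a => h𝓕 (he _))
    (h𝓕 (he _)) (fun a i => ((hagree _ (he _)).1 i).trans ((hagree _ (he _)).1 i).symm) ?_
  exact fun a b hab o o' => hω (a, o) (b, o') hab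

end GoodKernels

section EraseKernel

variable {α β : Type*} {r t N N' : ℕ} {S : Finset (Fin r)} {i : Fin r} {T : TreeCopy α β r t}
  {𝓕 𝓖 𝒯 : Finset (TreeCopy α β r t)} {Y : Finset β} {y : β}

theorem exists_core_notMem_of_pairwise_separate
    (hsep : (𝓕 : Set (TreeCopy α β r t)).Pairwise (Separate S)) (A : Finset α) (B : Finset β)
    (h : #A + #B < #𝓕) : ∃ T ∈ 𝓕, T.1 ∉ A ∧ ∀ j ∉ S, (T.2 j).1 ∉ B := by
  by_contra! hhit
  rw [← card_disjSum] at h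
  refine h.not_ge (card_le_card_of_forall_subsingleton
    (fun T v => v = .inl T.1 ∨ ∃ j ∉ S, v = .inr (T.2 j).1) (fun T hT => ?_) ?_)
  · by_cases hA : T.1 ∈ A
    · exact ⟨.inl T.1, inl_mem_disjSum.2 hA, .inl rfl⟩
    · obtain ⟨j, hj, hB⟩ := hhit T hT hA
      exact ⟨.inr (T.2 j).1, inr_mem_disjSum.2 hB, .inr ⟨j, hj, rfl⟩⟩
  · rintro v - T ⟨hT, hvT⟩ T' ⟨hT', hvT'⟩
    by_contra hne
    obtain ⟨hcentre, hmiddle⟩ := hsep hT hT' hne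
    rcases hvT with rfl | ⟨j, hj, rfl⟩ <;> rcases hvT' with hv | ⟨j', hj', hv⟩
    · exact hcentre (Sum.inl_injective hv)
    · cases hv
    · cases hv
    · exact hmiddle j hj j' hj' (Sum.inr_injective hv)

theorem exists_separate_erase (hsep : (𝓕 : Set (TreeCopy α β r t)).Pairwise (Separate S))
    (hy : y ∈ Y) (h𝓕 : ∀ T ∈ 𝓕, (T.2 i).1 = y)
    (h𝓖 : ∀ T ∈ 𝓖, (T.2 i).1 ≠ y ∧ ∀ j ∉ S, (T.2 j).1 ∉ Y) (hcard : #Y + (r + 1) * #𝓖 < #𝓕) :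
    ∃ T ∈ 𝓕, (∀ j ∉ S, (T.2 j).1 ∉ Y) ∧ ∀ T' ∈ 𝓖, Separate (S.erase i) T T' := by
  let M : Finset β := 𝓖.biUnion fun T => univ.image fun j => (T.2 j).1
  have hM : #M ≤ #𝓖 * r :=
    card_biUnion_le_card_mul _ _ _ fun T _ => card_image_le.trans_eq (card_fin r)
  obtain ⟨T, hT, hTcentre, hTmiddle⟩ := exists_core_notMem_of_pairwise_separate hsep
    (𝓖.image Prod.fst) (Y ∪ M) <| by
      have := card_image_le (s := 𝓖) (f := Prod.fst)
      have := card_union_le Y M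
      linarith
  refine ⟨T, hT, fun j hj hjY => hTmiddle j hj (mem_union_left _ hjY), fun T' hT' =>
    ⟨fun h => hTcentre (mem_image.2 ⟨T', hT', h.symm⟩), fun j hj k hk h => ?_⟩⟩
  by_cases hji : j = i
  · subst hji
    rw [h𝓕 T hT] at h
    by_cases hkj : k = j
    · exact (h𝓖 T' hT').1 (hkj ▸ h.symm)
    · exact (h𝓖 T' hT').2 k (fun hkS => hk (mem_erase.2 ⟨hkj, hkS⟩)) (h ▸ hy)
  · refine hTmiddle j (fun hjS => hj (mem_erase.2 ⟨hji, hjS⟩)) (mem_union_right _ ?_)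
    exact mem_biUnion.2 ⟨T', hT', mem_image.2 ⟨k, mem_univ _, h.symm⟩⟩

theorem exists_pairwise_separate_erase (hi : i ∈ S) (hN' : (r + 2) * #Y < N')
    (h : ∀ y ∈ Y, ∃ T', Agree (S.erase i) T' T ∧ (T'.2 i).1 = y ∧ IsKernel 𝒯 S N' T')
    {Y' : Finset β} (hY' : Y' ⊆ Y) :
    ∃ 𝓖 ⊆ 𝒯, #𝓖 = #Y' ∧ (𝓖 : Set (TreeCopy α β r t)).Pairwise (Separate (S.erase i)) ∧
      ∀ T' ∈ 𝓖, Agree (S.erase i) T' T ∧ (T'.2 i).1 ∈ Y' ∧ ∀ j ∉ S, (T'.2 j).1 ∉ Y := by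
  induction Y' using Finset.induction_on with
  | empty => exact ⟨∅, by simp⟩
  | insert y Y' hy ih =>
    obtain ⟨hyY, hsub⟩ := insert_subset_iff.1 hY'
    obtain ⟨𝓖, h𝓖, hcard, hsep, hprop⟩ := ih hsub
    obtain ⟨T₁, hT₁, rfl, 𝓕, h𝓕, hcard𝓕, hagree, hsep𝓕⟩ := h y hyY
    have hlt : #Y + (r + 1) * #𝓖 < #𝓕 := by
      have : (r + 1) * #𝓖 ≤ (r + 1) * #Y := Nat.mul_le_mul_left _ (hcard ▸ card_le_card hsub)
      linarith
    obtain ⟨T₂, hT₂, hmiddle, hsepT₂⟩ := exists_separate_erase hsep𝓕 hyY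
      (fun T' hT' => (hagree T' hT').2 i hi)
      (fun T' hT' => ⟨fun h => hy (h ▸ (hprop T' hT').2.1), (hprop T' hT').2.2⟩) hlt
    have hT₂𝓖 : T₂ ∉ 𝓖 := fun hmem => (hsepT₂ T₂ hmem).1 rfl
    refine ⟨insert T₂ 𝓖, insert_subset (h𝓕 hT₂) h𝓖, ?_, ?_, forall_mem_insert _ _ _ |>.2
      ⟨⟨Agree.trans ((hagree T₂ hT₂).mono (erase_subset i S)) hT₁, ?_, hmiddle⟩, ?_⟩⟩
    · rw [card_insert_of_notMem hT₂𝓖, card_insert_of_notMem hy, hcard]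
    · rw [coe_insert]
      exact hsep.insert fun T' hT' _ => ⟨hsepT₂ T' hT', (hsepT₂ T' hT').symm⟩
    · exact mem_insert.2 (.inl ((hagree T₂ hT₂).2 i hi))
    · exact fun T' hT' =>
        ⟨(hprop T' hT').1, mem_insert_of_mem (hprop T' hT').2.1, (hprop T' hT').2.2⟩

theorem isKernel_erase (hi : i ∈ S) (hN' : (r + 2) * N < N') (hY : N ≤ #Y)
    (h : ∀ y ∈ Y, ∃ T', Agree (S.erase i) T' T ∧ (T'.2 i).1 = y ∧ IsKernel 𝒯 S N' T') :
    IsKernel 𝒯 (S.erase i) N T := by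
  obtain ⟨Y₀, hY₀, rfl⟩ := exists_subset_card_eq hY
  obtain ⟨𝓖, h𝓖, hcard, hsep, hprop⟩ :=
    exists_pairwise_separate_erase hi hN' (fun y hy => h y (hY₀ hy)) subset_rfl
  exact ⟨𝓖, h𝓖, hcard.ge, fun T' hT' => (hprop T' hT').1, hsep⟩

end EraseKernel

section LightCounting

variable {α β : Type*} [Fintype β] {G : SimpleGraph (α ⊕ β)} {t k L m Δ : ℕ} {Z : Finset α}
  {P : β → Finset α}

theorem sum_card_lightTuples_le (W : Finset β) (hPZ : ∀ y, P y ⊆ Z)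
    (hadj : ∀ y, ∀ z ∈ P y, G.Adj (.inl z) (.inr y)) :
    ∑ y ∈ W, #(lightTuples G k L (P y)) ≤ L * #Z ^ k := by
  rw [← card_sigma, ← Fintype.card_piFinset_const]
  refine card_le_mul_card_image_of_maps_to (f := Sigma.snd) (fun q hq => ?_) L fun g _ => ?_
  · obtain ⟨hg, -⟩ := mem_filter.1 (mem_sigma.1 hq).2
    exact Fintype.mem_piFinset.2 fun j => hPZ _ (Fintype.mem_piFinset.1 hg j)
  rcases eq_empty_or_nonempty {q ∈ W.sigma fun y => lightTuples G k L (P y) | q.2 = g} with h | h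
  · simp [h]
  obtain ⟨q₀, h₀⟩ := h
  obtain ⟨hq₀, rfl⟩ := mem_filter.1 h₀
  obtain ⟨-, hlight⟩ := mem_filter.1 (mem_sigma.1 hq₀).2
  refine (card_le_card_of_injOn Sigma.fst (fun q hq => ?_) fun q hq q' hq' h => ?_).trans
    hlight.1.le
  · obtain ⟨hq, hqg⟩ := mem_filter.1 hq
    obtain ⟨hg, -⟩ := mem_filter.1 (mem_sigma.1 hq).2
    exact mem_commonNbrs.2 fun j => hqg ▸ hadj _ _ (Fintype.mem_piFinset.1 hg j)
  · exact Sigma.ext h (heq_of_eq ((mem_filter.1 hq).2.trans (mem_filter.1 hq').2.symm))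

theorem sum_card_le_of_card_rightNbrs_le (hPZ : ∀ y, P y ⊆ Z)
    (hadj : ∀ y, ∀ z ∈ P y, G.Adj (.inl z) (.inr y)) (hdeg : ∀ z, #(rightNbrs G z) ≤ Δ) :
    ∑ y, #(P y) ≤ #Z * Δ := by
  rw [← card_sigma, mul_comm]
  refine card_le_mul_card_image_of_maps_to (f := Sigma.snd)
    (fun q hq => hPZ _ (mem_sigma.1 hq).2) Δ fun z _ => le_trans ?_ (hdeg z)
  refine card_le_card_of_injOn Sigma.fst (fun q hq => ?_) fun q hq q' hq' h => ?_
  · obtain ⟨hqP, rfl⟩ := mem_filter.1 hq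
    exact mem_filter.2 ⟨mem_univ _, hadj _ _ (mem_sigma.1 hqP).2⟩
  · exact Sigma.ext h (heq_of_eq ((mem_filter.1 hq).2.trans (mem_filter.1 hq').2.symm))

theorem le_sum_of_le_sum_mul {ι : Type*} [Fintype ι] {p w : ι → ℝ} {A D ε : ℝ} (hp : ∀ i, 0 ≤ p i)
    (hw : ∀ i, w i ≤ D) (hA : ∑ i, p i ≤ A) (hD : 0 < D) (hε : 0 ≤ ε)
    (h : ε * D * A ≤ ∑ i, p i * w i) : ε / 2 * A ≤ ∑ i with ε / 2 * D ≤ w i, p i := by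
  have hheavy : ∑ i with ε / 2 * D ≤ w i, p i * w i ≤ D * ∑ i with ε / 2 * D ≤ w i, p i := by
    rw [mul_sum]
    exact sum_le_sum fun i _ => by nlinarith [hp i, hw i]
  have hlight : ∑ i with ¬ ε / 2 * D ≤ w i, p i * w i ≤ ε / 2 * D * A :=
    calc ∑ i with ¬ ε / 2 * D ≤ w i, p i * w i
        ≤ ∑ i with ¬ ε / 2 * D ≤ w i, ε / 2 * D * p i :=
          sum_le_sum fun i hi => by nlinarith [hp i, not_le.1 (mem_filter.1 hi).2]
      _ ≤ ∑ i, ε / 2 * D * p i :=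
          sum_le_univ_sum_of_nonneg fun i => mul_nonneg (by positivity) (hp i)
      _ ≤ ε / 2 * D * A := by
          rw [← mul_sum]
          gcongr
  rw [← sum_filter_add_sum_filter_not univ fun i => ε / 2 * D ≤ w i] at h
  refine le_of_mul_le_mul_left ?_ hD
  linarith

theorem LightTuplesDense.mul_pow_degree_le {w : β → ℕ} {M : ℕ} {c ε : ℝ}
    (hdense : LightTuplesDense G t L m c) (hc : 0 ≤ c) (hε : 0 < ε) (hΔ : 0 < Δ) (hZ : Z.Nonempty)
    (hPZ : ∀ y, P y ⊆ Z) (hadj : ∀ y, ∀ z ∈ P y, G.Adj (.inl z) (.inr y))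
    (hdeg : ∀ z, #(rightNbrs G z) ≤ Δ) (hw : ∀ y, w y ≤ Δ ^ t) (hm : ∀ y, w y ≠ 0 → m ≤ #(P y))
    (hM : ∑ y, w y ≤ M) (hsum : ε * Δ ^ (t + 1) * #Z ≤ ∑ y, (#(P y) * w y : ℝ)) :
    c * (ε / 2) ^ (2 * t + 1) * Δ ^ (t ^ 2 + t + 1) ≤ L * M ^ t := by
  have hD : (0 : ℝ) < Δ ^ t := by positivity
  have hZ₀ : (0 : ℝ) < #Z := Nat.cast_pos.2 hZ.card_pos
  set W : Finset β := {y | ε / 2 * (Δ : ℝ) ^ t ≤ w y}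
  have hWm : ∀ y ∈ W, m ≤ #(P y) := fun y hy => hm y fun h => by
    have := (mem_filter.1 hy).2
    rw [h, Nat.cast_zero] at this
    exact this.not_gt (by positivity)
  have hWM : ε / 2 * Δ ^ t * #W ≤ M := by
    rw [mul_comm, ← nsmul_eq_mul]
    refine (card_nsmul_le_sum W (fun y => (w y : ℝ)) _ fun y hy => (mem_filter.1 hy).2).trans ?_
    exact (sum_le_univ_sum_of_nonneg fun _ => Nat.cast_nonneg _).trans (by exact_mod_cast hM)
  have hWZ : ε / 2 * (#Z * Δ) ≤ ∑ y ∈ W, (#(P y) : ℝ) := by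
    refine le_sum_of_le_sum_mul (fun _ => Nat.cast_nonneg _) (fun y => by exact_mod_cast hw y) ?_ hD
      hε.le (hsum.trans_eq' (by ring))
    exact_mod_cast sum_card_le_of_card_rightNbrs_le hPZ hadj hdeg
  have hlight : c * ∑ y ∈ W, (#(P y) : ℝ) ^ (t + 1) ≤ L * #Z ^ (t + 1) := by
    rw [mul_sum]
    refine (sum_le_sum fun y hy => hdense _ (hWm y hy)).trans ?_
    exact_mod_cast sum_card_lightTuples_le W hPZ hadj
  have hW : c * (ε / 2 * Δ) ^ (t + 1) ≤ L * #W ^ t := by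
    refine le_of_mul_le_mul_left ?_ (pow_pos hZ₀ (t + 1))
    calc #Z ^ (t + 1) * (c * (ε / 2 * Δ) ^ (t + 1))
        = c * (ε / 2 * (#Z * Δ)) ^ (t + 1) := by ring
      _ ≤ c * (∑ y ∈ W, (#(P y) : ℝ)) ^ (t + 1) := by gcongr
      _ ≤ c * (#W ^ t * ∑ y ∈ W, (#(P y) : ℝ) ^ (t + 1)) := by
          gcongr
          exact pow_sum_le_card_mul_sum_pow (fun _ _ => Nat.cast_nonneg _) t
      _ = #W ^ t * (c * ∑ y ∈ W, (#(P y) : ℝ) ^ (t + 1)) := by ring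
      _ ≤ #W ^ t * (L * #Z ^ (t + 1)) := by gcongr
      _ = #Z ^ (t + 1) * (L * #W ^ t) := by ring
  calc c * (ε / 2) ^ (2 * t + 1) * Δ ^ (t ^ 2 + t + 1)
      = (ε / 2 * Δ ^ t) ^ t * (c * (ε / 2 * Δ) ^ (t + 1)) := by ring
    _ ≤ (ε / 2 * Δ ^ t) ^ t * (L * #W ^ t) := by gcongr
    _ = L * (ε / 2 * Δ ^ t * #W) ^ t := by ring
    _ ≤ L * M ^ t := by gcongr

end LightCounting

section Families

theorem card_image_centre_branch_le {α β : Type*} [Fintype β] {r t : ℕ}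
    (U : Finset (TreeCopy α β r t)) (i : Fin r) :
    #(U.image fun T => (T.1, T.2 i)) ≤
      ∑ y, #(({T ∈ U | (T.2 i).1 = y} : Finset _).image Prod.fst) *
        #{p ∈ U.image fun T => T.2 i | p.1 = y} := by
  simp only [← card_product]
  refine (card_le_card fun p hp => ?_).trans card_biUnion_le
  obtain ⟨T, hT, rfl⟩ := mem_image.1 hp
  exact mem_biUnion.2 ⟨(T.2 i).1, mem_univ _, mem_product.2
    ⟨mem_image_of_mem _ (mem_filter.2 ⟨hT, rfl⟩), mem_filter.2 ⟨mem_image_of_mem _ hT, rfl⟩⟩⟩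

variable {α β : Type*} [Fintype α] [Fintype β] {G : SimpleGraph (α ⊕ β)} {r t m L N n Δ K : ℕ}
  {c ε : ℝ} {U : Finset (TreeCopy α β r t)} {i : Fin r}

theorem card_le_mul_card_image_centre_branch (hU : U ⊆ goodCopies G r t L)
    (hleaf : ∀ T ∈ U, ∀ T' ∈ U, ∀ j ≠ i, (T.2 j).2 = (T'.2 j).2) :
    #U ≤ L ^ r * #(U.image fun T => (T.1, T.2 i)) := by
  refine card_le_mul_card_image U _ fun p hp => ?_
  obtain ⟨T₀, hT₀, rfl⟩ := mem_image.1 hp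
  refine (card_le_card fun T hT => ?_).trans
    (card_goodCopies_filter_le (G := G) T₀.1 fun j => (T₀.2 j).2)
  obtain ⟨hTU, heq⟩ := mem_filter.1 hT
  obtain ⟨hcentre, hbranch⟩ := Prod.ext_iff.1 heq
  refine mem_filter.2 ⟨hU hTU, hcentre, fun j => ?_⟩
  by_cases hj : j = i
  · subst hj
    exact congrArg Prod.snd hbranch
  · exact hleaf T hTU T₀ hT₀ j hj

theorem AlmostRegular.card_branches_filter_le (hG : AlmostRegular G n Δ K)
    (hU : U ⊆ goodCopies G r t L) (i : Fin r) (y : β) :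
    #{p ∈ U.image fun T => T.2 i | p.1 = y} ≤ Δ ^ t := by
  calc #{p ∈ U.image fun T => T.2 i | p.1 = y}
      ≤ #(Fintype.piFinset fun _ : Fin t => leftNbrs G y) := by
        refine card_le_card_of_injOn Prod.snd (fun p hp => ?_) fun p hp q hq h =>
          Prod.ext ((mem_filter.1 hp).2.trans (mem_filter.1 hq).2.symm) h
        obtain ⟨hpU, rfl⟩ := mem_filter.1 hp
        obtain ⟨T, hT, rfl⟩ := mem_image.1 hpU
        exact Fintype.mem_piFinset.2 (mem_branches.1 (mem_branches_of_mem_goodCopies (hU hT) i)).2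
    _ ≤ Δ ^ t := by
        rw [Fintype.card_piFinset_const]
        exact Nat.pow_le_pow_left (hG.card_leftNbrs_le y) t

theorem LightTuplesDense.mul_pow_degree_le_of_goodCopies (hG : AlmostRegular G n Δ K)
    (hdense : LightTuplesDense G t L m c) (hc : 0 ≤ c) (hε : 0 < ε) (hΔ : 0 < Δ)
    (hU : U ⊆ goodCopies G r t L) (hne : U.Nonempty)
    (hleaf : ∀ T ∈ U, ∀ T' ∈ U, ∀ j ≠ i, (T.2 j).2 = (T'.2 j).2)
    (hN : ∀ x, #{p ∈ U.image fun T => T.2 i | p.2 = x} ≤ N)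
    (hm : ∀ T ∈ U, m ≤ #(({T' ∈ U | (T'.2 i).1 = (T.2 i).1} : Finset _).image Prod.fst))
    (hsum : ε * Δ ^ (t + 1) * #(U.image Prod.fst) ≤ #U) :
    c * (ε / (2 * L ^ r)) ^ (2 * t + 1) * Δ ^ (t ^ 2 + t + 1) ≤ L * (N * n ^ t) ^ t := by
  have hL : (0 : ℝ) < L ^ r := by
    obtain ⟨T, hT⟩ := hne
    exact pow_pos (Nat.cast_pos.2 (Nat.zero_lt_of_lt (light_of_mem_goodCopies (hU hT) i).1)) r
  have hmiddle : ∑ y, #{p ∈ U.image fun T => T.2 i | p.1 = y} ≤ N * n ^ t := by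
    refine (card_eq_sum_card_fiberwise fun _ _ => mem_coe.2 (mem_univ _)).symm.trans_le ?_
    calc #(U.image fun T => T.2 i)
        ≤ N * #((U.image fun T => T.2 i).image Prod.snd) :=
          card_le_mul_card_image _ N fun x _ => hN x
      _ ≤ N * n ^ t := by
          gcongr
          refine (card_le_univ _).trans ?_
          rw [Fintype.card_fun, Fintype.card_fin]
          exact Nat.pow_le_pow_left hG.card_left t
  have hpairs : ε / L ^ r * Δ ^ (t + 1) * #(U.image Prod.fst) ≤
      ∑ y, (#(({T ∈ U | (T.2 i).1 = y} : Finset _).image Prod.fst) *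
        #{p ∈ U.image fun T => T.2 i | p.1 = y} : ℝ) := by
    have hcard : (#U : ℝ) ≤ L ^ r * ∑ y, (#(({T ∈ U | (T.2 i).1 = y} : Finset _).image Prod.fst) *
        #{p ∈ U.image fun T => T.2 i | p.1 = y} : ℝ) := by
      exact_mod_cast (card_le_mul_card_image_centre_branch hU hleaf).trans
        (Nat.mul_le_mul_left _ (card_image_centre_branch_le U i))
    rw [div_mul_eq_mul_div, div_mul_eq_mul_div, div_le_iff₀' hL]
    exact hsum.trans hcard
  have key := hdense.mul_pow_degree_le (ε := ε / L ^ r) hc (by positivity) hΔ (hne.image Prod.fst)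
    (fun y => image_subset_image (filter_subset _ _)) (fun y z hz => ?_) hG.card_rightNbrs_le
    (hG.card_branches_filter_le hU i) (fun y hy => ?_) hmiddle hpairs
  · rw [div_div, mul_comm _ (2 : ℝ)] at key
    exact_mod_cast key
  · obtain ⟨T, hT, rfl⟩ := mem_image.1 hz
    obtain ⟨hTU, rfl⟩ := mem_filter.1 hT
    exact adj_centre_of_mem_goodCopies (hU hTU) i
  · obtain ⟨p, hp⟩ := card_ne_zero.1 hy
    obtain ⟨hpU, rfl⟩ := mem_filter.1 hp
    obtain ⟨T, hT, rfl⟩ := mem_image.1 hpU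
    exact hm T hT

end Families

section Contexts

theorem exists_mul_card_image_filter_lt {γ ι κ : Type*} [DecidableEq ι] [DecidableEq κ]
    {U : Finset γ} {f : γ → κ} {g : γ → ι} {c : ℝ} (hc : 0 ≤ c)
    (h : c * #(U.image fun a => (g a, f a)) < #U) :
    ∃ k, c * #(({a ∈ U | f a = k} : Finset _).image g) < #{a ∈ U | f a = k} := by
  by_contra! hle
  have himage : ∑ k ∈ U.image f, #(({a ∈ U | f a = k} : Finset _).image g) ≤
      #(U.image fun a => (g a, f a)) := by
    rw [← card_sigma]
    refine card_le_card_of_injOn (fun p => (p.2, p.1)) (fun p hp => ?_) fun p _ q _ hpq => ?_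
    · obtain ⟨a, ha, hap⟩ := mem_image.1 (mem_sigma.1 hp).2
      obtain ⟨haU, hak⟩ := mem_filter.1 ha
      exact mem_image.2 ⟨a, haU, Prod.ext hap hak⟩
    · obtain ⟨h₂, h₁⟩ := Prod.ext_iff.1 hpq
      exact Sigma.ext h₁ (heq_of_eq h₂)
  refine h.not_ge ?_
  rw [card_eq_sum_card_image f U, Nat.cast_sum]
  calc ∑ k ∈ U.image f, (#{a ∈ U | f a = k} : ℝ)
      ≤ ∑ k ∈ U.image f, c * #(({a ∈ U | f a = k} : Finset _).image g) :=
        sum_le_sum fun k _ => hle k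
    _ ≤ c * #(U.image fun a => (g a, f a)) := by
        rw [← mul_sum]
        gcongr
        exact_mod_cast himage

variable {α β κ : Type*} [Fintype α] [Fintype β] [DecidableEq κ] {G : SimpleGraph (α ⊕ β)}
  {r t n Δ K L : ℕ} {U : Finset (TreeCopy α β r t)} {i : Fin r}

theorem AlmostRegular.card_image_centre_le (hG : AlmostRegular G n Δ K)
    (hU : U ⊆ goodCopies G r t L) (f : ({j // j ≠ i} → Branch α β t) → κ) :
    #(U.image fun T => (T.1, f fun j => T.2 j)) ≤ n * (Δ ^ (t + 1)) ^ (r - 1) := by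
  calc #(U.image fun T => (T.1, f fun j => T.2 j))
      ≤ #((univ.sigma fun z => Fintype.piFinset fun _ : {j // j ≠ i} => branches G t z).image
          fun p => (p.1, f p.2)) := by
        refine card_le_card fun q hq => ?_
        obtain ⟨T, hT, rfl⟩ := mem_image.1 hq
        exact mem_image.2 ⟨⟨T.1, fun j => T.2 j⟩, mem_sigma.2 ⟨mem_univ _,
          Fintype.mem_piFinset.2 fun j => mem_branches_of_mem_goodCopies (hU hT) j⟩, rfl⟩
    _ ≤ ∑ z, #(branches G t z) ^ (r - 1) := by
        refine card_image_le.trans_eq ?_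
        simp only [card_sigma, Fintype.card_piFinset, prod_const, card_univ,
          Fintype.card_subtype_compl, Fintype.card_subtype_eq, Fintype.card_fin]
    _ ≤ Fintype.card α * (Δ ^ (t + 1)) ^ (r - 1) :=
        sum_le_card_nsmul _ _ _ fun z _ => Nat.pow_le_pow_left (hG.card_branches_le t z) _
    _ ≤ n * (Δ ^ (t + 1)) ^ (r - 1) := Nat.mul_le_mul_right _ hG.card_left

theorem AlmostRegular.exists_mul_card_centres_lt {ε : ℝ} (hG : AlmostRegular G n Δ K)
    (hU : U ⊆ goodCopies G r t L) (f : ({j // j ≠ i} → Branch α β t) → κ) (hε : 0 ≤ ε)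
    (h : ε * n * Δ ^ (r * (t + 1)) < #U) :
    ∃ k, ε * Δ ^ (t + 1) *
        #(({T ∈ U | (f fun j => T.2 j) = k} : Finset _).image Prod.fst) <
      #{T ∈ U | (f fun j => T.2 j) = k} := by
  refine exists_mul_card_image_filter_lt (by positivity) (h.trans_le' ?_)
  calc ε * Δ ^ (t + 1) * #(U.image fun T => (T.1, f fun j => T.2 j))
      ≤ ε * Δ ^ (t + 1) * (n * (Δ ^ (t + 1)) ^ (r - 1)) := by
        gcongr
        exact_mod_cast hG.card_image_centre_le hU f
    _ = ε * n * (Δ ^ (t + 1)) ^ (r - 1 + 1) := by ring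
    _ = ε * n * Δ ^ (r * (t + 1)) := by rw [Nat.sub_add_cancel i.pos, ← pow_mul, mul_comm r]

end Contexts

section EraseStep

variable {α β : Type*} {r t N N' : ℕ} {S : Finset (Fin r)} {i : Fin r} {T : TreeCopy α β r t}
  {𝒯 V : Finset (TreeCopy α β r t)}

/-- What the branches other than `i` prescribe: their leaves, and the middle vertices of those that
belong to `S`. -/
def context (S : Finset (Fin r)) (i : Fin r) (w : {j // j ≠ i} → Branch α β t) :
    ({j // j ≠ i} → Fin t → α) × ({j : {j // j ≠ i} // j.1 ∈ S} → β) :=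
  (fun j => (w j).2, fun j => (w j).1)

theorem context_eq_iff {T T' : TreeCopy α β r t} :
    (context S i fun j => T.2 j) = (context S i fun j => T'.2 j) ↔
      ∀ j ≠ i, (T.2 j).2 = (T'.2 j).2 ∧ (j ∈ S → (T.2 j).1 = (T'.2 j).1) := by
  simp only [context, Prod.ext_iff, funext_iff, Subtype.forall]
  exact ⟨fun h j hj => ⟨h.1 j hj, h.2 j hj⟩,
    fun h => ⟨fun j hj => (h j hj).1, fun j hj => (h j hj).2⟩⟩

theorem card_branches_filter_leaves_le (hi : i ∈ S) (hN' : (r + 2) * N < N')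
    (hV : ∀ T ∈ V, IsKernel 𝒯 S N' T ∧ ¬ IsKernel 𝒯 (S.erase i) N T)
    (hcontext : ∀ T ∈ V, ∀ T' ∈ V, (context S i fun j => T.2 j) = context S i fun j => T'.2 j)
    (x : Fin t → α) : #{p ∈ V.image fun T => T.2 i | p.2 = x} ≤ N := by
  by_contra! hlt
  obtain ⟨p, hp⟩ := card_pos.1 (Nat.zero_lt_of_lt hlt)
  obtain ⟨hpV, rfl⟩ := mem_filter.1 hp
  obtain ⟨T₀, hT₀, rfl⟩ := mem_image.1 hpV
  refine (hV T₀ hT₀).2 (isKernel_erase hi hN'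
    (Y := ({p ∈ V.image fun T => T.2 i | p.2 = (T₀.2 i).2} : Finset _).image Prod.fst) ?_ ?_)
  · rw [card_image_of_injOn]
    · exact hlt.le
    · exact fun p hp q hq h => Prod.ext h ((mem_filter.1 hp).2.trans (mem_filter.1 hq).2.symm)
  · intro y hy
    obtain ⟨p, hp, rfl⟩ := mem_image.1 hy
    obtain ⟨hpV, hleaf⟩ := mem_filter.1 hp
    obtain ⟨T, hT, rfl⟩ := mem_image.1 hpV
    have hagree := context_eq_iff.1 (hcontext T hT T₀ hT₀)
    refine ⟨T, ⟨fun j => ?_, fun j hj => ?_⟩, rfl, (hV T hT).1⟩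
    · by_cases hj : j = i
      · rwa [hj]
      · exact (hagree j hj).1
    · exact (hagree j (ne_of_mem_erase hj)).2 (mem_of_mem_erase hj)

theorem IsKernel.le_card_centres (h : IsKernel 𝒯 S N T) (hi : i ∈ S)
    (hV : ∀ T' ∈ 𝒯, Agree S T' T → T' ∈ V) :
    N ≤ #(({T' ∈ V | (T'.2 i).1 = (T.2 i).1} : Finset _).image Prod.fst) := by
  obtain ⟨𝓕, h𝓕, hcard, hagree, hsep⟩ := h
  calc N ≤ #𝓕 := hcard
    _ = #(𝓕.image Prod.fst) := (card_image_of_injOn fun T₁ h₁ T₂ h₂ heq => by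
        by_contra hne
        exact (hsep h₁ h₂ hne).1 heq).symm
    _ ≤ _ := card_le_card <| image_subset_image fun T' hT' => mem_filter.2
        ⟨hV T' (h𝓕 hT') (hagree T' hT'), (hagree T' hT').2 i hi⟩

variable [Fintype α] [Fintype β] {G : SimpleGraph (α ⊕ β)} {m L n Δ K : ℕ} {c ε : ℝ}

theorem AlmostRegular.le_card_isKernel_erase (hG : AlmostRegular G n Δ K)
    (hdense : LightTuplesDense G t L m c) (hc : 0 ≤ c) (hε : 0 < ε) (hΔ : 0 < Δ)
    (hbig : L * (N * n ^ t : ℝ) ^ t < c * (ε / (2 * L ^ r)) ^ (2 * t + 1) * Δ ^ (t ^ 2 + t + 1))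
    (hi : i ∈ S) (hN' : (r + 2) * N < N') (hm : m ≤ N')
    (hS : 2 * ε * n * Δ ^ (r * (t + 1)) ≤
      #{T ∈ goodCopies G r t L | IsKernel (goodCopies G r t L) S N' T}) :
    ε * n * Δ ^ (r * (t + 1)) ≤
      #{T ∈ goodCopies G r t L | IsKernel (goodCopies G r t L) (S.erase i) N T} := by
  by_contra! hfew
  set 𝒯 := goodCopies G r t L
  set U : Finset (TreeCopy α β r t) :=
    {T ∈ 𝒯 | IsKernel 𝒯 S N' T ∧ ¬ IsKernel 𝒯 (S.erase i) N T} with hU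
  have hUbig : ε * n * Δ ^ (r * (t + 1)) < #U := by
    have hsplit : #{T ∈ 𝒯 | IsKernel 𝒯 S N' T} ≤
        #{T ∈ 𝒯 | IsKernel 𝒯 (S.erase i) N T} + #U := by
      refine (card_le_card fun T hT => ?_).trans (card_union_le _ _)
      simp only [hU, mem_union, mem_filter] at hT ⊢
      tauto
    have : (#{T ∈ 𝒯 | IsKernel 𝒯 S N' T} : ℝ) ≤
        #{T ∈ 𝒯 | IsKernel 𝒯 (S.erase i) N T} + #U := by exact_mod_cast hsplit
    linarith
  obtain ⟨k, hk⟩ := hG.exists_mul_card_centres_lt (filter_subset _ _) (context S i) hε.le hUbig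
  set V : Finset (TreeCopy α β r t) := {T ∈ U | (context S i fun j => T.2 j) = k}
  have hV : ∀ T ∈ V, T ∈ 𝒯 ∧ IsKernel 𝒯 S N' T ∧ ¬ IsKernel 𝒯 (S.erase i) N T := fun T hT =>
    mem_filter.1 (mem_filter.1 hT).1
  have hcontext : ∀ T ∈ V, ∀ T' ∈ V,
      (context S i fun j => T.2 j) = context S i fun j => T'.2 j := fun T hT T' hT' =>
    (mem_filter.1 hT).2.trans (mem_filter.1 hT').2.symm
  have hclosed : ∀ T ∈ V, ∀ T' ∈ 𝒯, Agree S T' T → T' ∈ V := fun T hT T' hT' h =>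
    mem_filter.2 ⟨mem_filter.2 ⟨hT', (hV T hT).2.1.of_agree h.symm, fun hker =>
      (hV T hT).2.2 (hker.of_agree (h.mono (erase_subset i S)))⟩,
      (context_eq_iff.2 fun j _ => ⟨h.1 j, h.2 j⟩).trans (mem_filter.1 hT).2⟩
  have hVne : V.Nonempty := card_pos.1 (Nat.cast_pos.1 (hk.trans_le' (by positivity)))
  exact hbig.not_ge <| hdense.mul_pow_degree_le_of_goodCopies hG hc hε hΔ (fun T hT => (hV T hT).1)
    hVne (fun T hT T' hT' j hj => (context_eq_iff.1 (hcontext T hT T' hT') j hj).1)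
    (card_branches_filter_leaves_le hi hN' (fun T hT => (hV T hT).2) hcontext)
    (fun T hT => hm.trans ((hV T hT).2.1.le_card_centres hi (hclosed T hT))) hk.le

/-- The size of the kernels needed to erase `k` branches one by one and end up with `N` copies. -/
def kernelSize (r m N : ℕ) : ℕ → ℕ
  | 0 => N
  | k + 1 => (r + 2) * kernelSize r m N k + m + 1

theorem kernelSize_mono (r m N : ℕ) : Monotone (kernelSize r m N) :=
  monotone_nat_of_le_succ fun k => by
    rw [kernelSize]
    nlinarith [Nat.zero_le (r * kernelSize r m N k)]

theorem AlmostRegular.exists_isKernel_empty {k : ℕ} (hG : AlmostRegular G n Δ K)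
    (hdense : LightTuplesDense G t L m c) (hc : 0 ≤ c) (hε : 0 < ε) (hn : 0 < n) (hΔ : 0 < Δ)
    (hN' : kernelSize r m N k ≤ N')
    (hbig : L * (N' * n ^ t : ℝ) ^ t < c * (ε / (2 * L ^ r)) ^ (2 * t + 1) * Δ ^ (t ^ 2 + t + 1))
    (hS : #S = k) (hcard : 2 ^ k * ε * n * Δ ^ (r * (t + 1)) ≤
      #{T ∈ goodCopies G r t L | IsKernel (goodCopies G r t L) S N' T}) :
    ∃ T, IsKernel (goodCopies G r t L) ∅ N T := by
  induction k generalizing S N' with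
  | zero =>
    obtain rfl := card_eq_zero.1 hS
    obtain ⟨T, hT⟩ := card_pos.1 (Nat.cast_pos.1 (hcard.trans_lt' (by positivity)))
    obtain ⟨𝓕, h𝓕, hcard𝓕, hrest⟩ := (mem_filter.1 hT).2
    exact ⟨T, 𝓕, h𝓕, hN'.trans hcard𝓕, hrest⟩
  | succ k ih =>
    obtain ⟨i, hi⟩ : S.Nonempty := card_pos.1 (hS ▸ k.succ_pos)
    rw [kernelSize] at hN'
    have hle : kernelSize r m N k ≤ N' := by nlinarith [Nat.zero_le (r * kernelSize r m N k)]
    have hbig' : L * (kernelSize r m N k * n ^ t : ℝ) ^ t <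
        c * (ε / (2 * L ^ r)) ^ (2 * t + 1) * Δ ^ (t ^ 2 + t + 1) :=
      hbig.trans_le' (by gcongr)
    refine ih (S := S.erase i) le_rfl hbig'
      (by rw [card_erase_of_mem hi, hS, Nat.add_sub_cancel]) ?_
    refine hG.le_card_isKernel_erase hdense hc (by positivity) hΔ (hbig'.trans_le ?_) hi
      (by omega) (by omega) (hcard.trans_eq' (by ring))
    gcongr
    exact le_mul_of_one_le_left hε.le (one_le_pow₀ one_le_two)

theorem AlmostRegular.exists_le_card_isKernel (hG : AlmostRegular G n Δ K)
    (hgood : 2 * ε * n * Δ ^ (r * (t + 1)) ≤ #(goodCopies G r t L))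
    (hsunflower : sunflowerBound r N (L ^ r) r * (n : ℝ) ^ (r * t) ≤ ε * n * Δ ^ (r * (t + 1))) :
    ∃ S, ε / 2 ^ r * n * Δ ^ (r * (t + 1)) ≤
      #{T ∈ goodCopies G r t L | IsKernel (goodCopies G r t L) S N T} := by
  set 𝒯 := goodCopies G r t L
  have hnot : (#{T ∈ 𝒯 | ∀ S, ¬ IsKernel 𝒯 S N T} : ℝ) ≤ ε * n * Δ ^ (r * (t + 1)) := by
    refine hsunflower.trans' ?_
    exact_mod_cast (card_not_isKernel_le N).trans
      (Nat.mul_le_mul_left _ (Nat.pow_le_pow_left hG.card_left _))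
  have hcover : #𝒯 ≤ #{T ∈ 𝒯 | ∀ S, ¬ IsKernel 𝒯 S N T} + ∑ S, #{T ∈ 𝒯 | IsKernel 𝒯 S N T} := by
    rw [← card_filter_add_card_filter_not (s := 𝒯) fun T => ∀ S, ¬ IsKernel 𝒯 S N T]
    refine Nat.add_le_add_left ((card_le_card fun T hT => ?_).trans card_biUnion_le) _
    obtain ⟨hT, hker⟩ := mem_filter.1 hT
    obtain ⟨S, hS⟩ := not_forall_not.1 hker
    exact mem_biUnion.2 ⟨S, mem_univ _, mem_filter.2 ⟨hT, hS⟩⟩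
  obtain ⟨S, -, hS⟩ := exists_le_of_sum_le (s := (univ : Finset (Finset (Fin r))))
    (f := fun _ => ε / 2 ^ r * n * (Δ : ℝ) ^ (r * (t + 1)))
    (g := fun S => (#{T ∈ 𝒯 | IsKernel 𝒯 S N T} : ℝ)) univ_nonempty <| by
      have hcover' : (#𝒯 : ℝ) ≤ #{T ∈ 𝒯 | ∀ S, ¬ IsKernel 𝒯 S N T} +
          ∑ S, (#{T ∈ 𝒯 | IsKernel 𝒯 S N T} : ℝ) := by exact_mod_cast hcover
      have hconst : (2 : ℝ) ^ r * (ε / 2 ^ r * n * Δ ^ (r * (t + 1))) =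
        ε * n * Δ ^ (r * (t + 1)) := by field_simp
      simp only [sum_const, card_univ, Fintype.card_finset, Fintype.card_fin, nsmul_eq_mul,
        Nat.cast_pow, Nat.cast_ofNat]
      linarith
  exact ⟨S, hS⟩

theorem AlmostRegular.exists_isKernel_empty_of_le_card_goodCopies (hG : AlmostRegular G n Δ K)
    (hdense : LightTuplesDense G t L m c) (hc : 0 ≤ c) (hε : 0 < ε) (hn : 0 < n) (hΔ : 0 < Δ)
    (hN' : kernelSize r m N r ≤ N')
    (hgood : 2 * ε * n * Δ ^ (r * (t + 1)) ≤ #(goodCopies G r t L))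
    (hsunflower : sunflowerBound r N' (L ^ r) r * (n : ℝ) ^ (r * t) ≤ ε * n * Δ ^ (r * (t + 1)))
    (hbig : L * (N' * n ^ t : ℝ) ^ t <
      c * (ε / 4 ^ r / (2 * L ^ r)) ^ (2 * t + 1) * Δ ^ (t ^ 2 + t + 1)) :
    ∃ T, IsKernel (goodCopies G r t L) ∅ N T := by
  obtain ⟨S, hS⟩ := hG.exists_le_card_isKernel hgood hsunflower
  have hSr : #S ≤ r := (card_le_univ S).trans_eq (Fintype.card_fin r)
  refine hG.exists_isKernel_empty (ε := ε / 4 ^ r) hdense hc (by positivity) hn hΔ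
    ((kernelSize_mono r m N hSr).trans hN') hbig rfl (hS.trans' ?_)
  gcongr
  calc 2 ^ #S * (ε / 4 ^ r) ≤ 2 ^ r * (ε / 4 ^ r) := by gcongr; exact one_le_two
    _ = ε / 2 ^ r := by
        rw [show (4 : ℝ) = 2 * 2 by norm_num, mul_pow]
        field_simp

end EraseStep

section AlmostRegularGraphs

theorem exists_le_card_goodCopies (s r t : ℕ) {K m : ℕ} {c : ℝ} (hr : r ≠ 0) (hK : 0 < K)
    (hc : 0 < c) : ∃ ε > 0, ∃ C : ℕ, ∀ {α β : Type*} [Fintype α] [Fintype β]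
      {G : SimpleGraph (α ⊕ β)} {n Δ L : ℕ}, (completeBipartiteGraph (Fin s) (Fin s)).Free G →
      AlmostRegular G n Δ K → LightTuplesDense G t L m c → 0 < n → C ≤ Δ →
      2 * ε * n * Δ ^ (r * (t + 1)) ≤ (#(goodCopies G r t L) : ℝ) := by
  set b : ℝ := c / (2 * K) ^ (t + 1)
  have hb : 0 < b := by positivity
  set η : ℝ := b ^ r / (2 * (r * (t + 1)) ^ 2)
  have hη : 0 < η := by positivity
  obtain ⟨N₁, -, hN₁⟩ := exists_fewClashes_of_free s (η := 1 / K ^ 2) (by positivity)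
  obtain ⟨N₂, -, hN₂⟩ := exists_fewClashes_of_free s hη
  refine ⟨b ^ r / 4, by positivity, K ^ 2 * N₁ + 1 + N₂ + 2 * K * m,
    fun {α β} _ _ {G n Δ L} hfree hG hdense hn hΔ => ?_⟩
  obtain ⟨hα, hβ⟩ := hG.degree_le_card hn hK (hN₁ G hfree) (by omega)
  refine (hG.le_card_goodCopies (hN₂ G hfree) hη.le (by omega) hα hβ hr hb.le
    (hG.le_sum_card_lightBranches hdense hc.le hK (by omega)) ?_).trans_eq' (by ring)
  exact (by simp only [η]; field_simp : (r * (t + 1) : ℝ) ^ 2 * η = b ^ r / 2).le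

theorem exists_hasPower_of_almostRegular (s r t ℓ K : ℕ) (hr : r ≠ 0) (hK : 0 < K) :
    ∃ C : ℝ, 0 < C ∧ ∀ {α β : Type*} [Fintype α] [Fintype β] {G : SimpleGraph (α ⊕ β)} {n Δ : ℕ},
      (completeBipartiteGraph (Fin s) (Fin s)).Free G → AlmostRegular G n Δ K → 0 < n → C ≤ Δ →
      C * n ^ t ^ 2 ≤ (Δ : ℝ) ^ (t ^ 2 + t + 1) →
      C * n ^ (r * t) ≤ (n * Δ ^ (r * (t + 1)) : ℝ) → HasPower G r t ℓ := by
  obtain ⟨L, hL, hlight⟩ := exists_fewClashes_of_free s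
    (η := 1 / (Fintype.card (PowerVertex r t ℓ) ^ 2 + 1)) (by positivity)
  obtain ⟨M, hM, hempty⟩ := exists_fewClashes_of_free s (η := 1 / ((ℓ * (r + 1)) ^ 2 + 1))
    (by positivity)
  set m := 2 * L ^ 2
  set c : ℝ := 1 / (2 * L ^ (t + 1))
  have hc : 0 < c := by positivity
  obtain ⟨ε, hε, C₁, hgood⟩ := exists_le_card_goodCopies s r t (m := m) hr hK hc
  set N := kernelSize r m M r
  set δ : ℝ := c * (ε / 4 ^ r / (2 * L ^ r)) ^ (2 * t + 1)
  have hδ : 0 < δ := by positivity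
  set C₂ : ℝ := L * N ^ t / δ + 1
  set C₃ : ℝ := sunflowerBound r N (L ^ r) r / ε
  refine ⟨C₁ + C₂ + C₃, by positivity, fun {α β} _ _ {G n Δ} hfree hG hn hΔ hbig hcount => ?_⟩
  by_contra hpow
  have : 0 ≤ (C₁ : ℝ) := by positivity
  have hC₂ : 0 < C₂ := by positivity
  have hC₃ : 0 ≤ C₃ := by positivity
  have : (0 : ℝ) < n := Nat.cast_pos.2 hn
  have hΔ₀ : 0 < Δ := Nat.cast_pos.1 (hΔ.trans_lt' (by positivity))
  have hdense : LightTuplesDense G t L m c := lightTuplesDense_of_not_hasPower (hlight G hfree)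
    (by positivity) (by rw [mul_one_div, div_lt_one (by positivity)]; linarith) hL hpow
  have hsunflower : sunflowerBound r N (L ^ r) r * (n : ℝ) ^ (r * t) ≤
      ε * n * Δ ^ (r * (t + 1)) :=
    calc sunflowerBound r N (L ^ r) r * (n : ℝ) ^ (r * t)
        = ε * (C₃ * n ^ (r * t)) := by simp only [C₃]; field_simp
      _ ≤ ε * ((C₁ + C₂ + C₃) * n ^ (r * t)) := by gcongr; linarith
      _ ≤ ε * n * Δ ^ (r * (t + 1)) := by rw [mul_assoc]; gcongr
  have hlarge : L * (N * n ^ t : ℝ) ^ t < δ * Δ ^ (t ^ 2 + t + 1) :=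
    calc L * (N * n ^ t : ℝ) ^ t = δ * ((C₂ - 1) * n ^ t ^ 2) := by simp only [C₂]; field_simp; ring
      _ < δ * ((C₁ + C₂ + C₃) * n ^ t ^ 2) := by gcongr; linarith
      _ ≤ δ * Δ ^ (t ^ 2 + t + 1) := by gcongr
  obtain ⟨T, hT⟩ := hG.exists_isKernel_empty_of_le_card_goodCopies hdense hc.le hε hn hΔ₀ le_rfl
    (hgood hfree hG hdense hn (Nat.cast_le.1 ((by linarith : (C₁ : ℝ) ≤ C₁ + C₂ + C₃).trans hΔ)))
    hsunflower hlarge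
  exact hpow <| hT.hasPower (hempty G hfree) (by positivity)
    (by rw [mul_one_div, div_lt_one (by positivity)]; linarith) le_rfl hM

end AlmostRegularGraphs

section AlmostRegularSubset

variable {V : Type*} (E : V → V → Prop)

theorem card_interedges_eq_sum_out (U W : Finset V) :
    #(Rel.interedges E U W) = ∑ v ∈ U, #{w ∈ W | E v w} := by
  simp only [Rel.interedges, card_filter, sum_product]

theorem card_interedges_eq_sum_in (U W : Finset V) :
    #(Rel.interedges E U W) = ∑ w ∈ W, #{v ∈ U | E v w} := by
  simp only [Rel.interedges, card_filter, sum_product_right]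

theorem card_interedges_le_sdiff_add_sum (H : Finset V) {U : Finset V} (P : Finpartition U) :
    #(Rel.interedges E U U) ≤
      #(Rel.interedges E (U \ H) (U \ H)) +
        ∑ A ∈ P.parts, #(Rel.interedges E (H ∪ A) (H ∪ A)) := by
  have hcover : Rel.interedges E U U ⊆ Rel.interedges E (U \ H) (U \ H) ∪
      P.parts.biUnion fun A => Rel.interedges E (H ∪ A) (H ∪ A) := by
    rintro ⟨v, w⟩ hvw
    obtain ⟨hv, hw, hE⟩ := Rel.mk_mem_interedges_iff.1 hvw
    simp only [mem_union, mem_biUnion, Rel.mk_mem_interedges_iff, mem_sdiff]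
    by_cases hvH : v ∈ H
    · obtain ⟨A, hA, hwA⟩ := P.exists_mem hw
      exact .inr ⟨A, hA, .inl hvH, .inr hwA, hE⟩
    · by_cases hwH : w ∈ H
      · obtain ⟨A, hA, hvA⟩ := P.exists_mem hv
        exact .inr ⟨A, hA, .inr hvA, .inl hwH, hE⟩
      · exact .inl ⟨⟨hv, hvH⟩, ⟨hw, hwH⟩, hE⟩
  exact (card_le_card hcover).trans
    ((card_union_le _ _).trans (Nat.add_le_add_left card_biUnion_le _))

theorem exists_finpartition_card_union_le {U H : Finset V} {k : ℕ} (hk : k ≠ 0) (hkU : k ≤ #U)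
    (hH : k * #H ≤ #U) :
    ∃ P : Finpartition U, #P.parts = k ∧ ∀ A ∈ P.parts, (#(H ∪ A) : ℝ) ≤ 3 / k * #U := by
  obtain ⟨P, hP, hcard⟩ := Finpartition.exists_equipartition_card_eq U hk hkU
  refine ⟨P, hcard, fun A hA => ?_⟩
  have hA : #A ≤ #U / k + 1 := hcard ▸ hP.card_part_le_average_add_one hA
  have hk' : 0 < (k : ℝ) := Nat.cast_pos.2 (Nat.pos_of_ne_zero hk)
  rw [div_mul_eq_mul_div, le_div_iff₀ hk']
  have hunion : k * #(H ∪ A) ≤ 3 * #U :=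
    calc k * #(H ∪ A) ≤ k * (#H + (#U / k + 1)) := by
          gcongr; exact (card_union_le _ _).trans (Nat.add_le_add_left hA _)
      _ = k * #H + k * (#U / k) + k := by ring
      _ ≤ 3 * #U := by linarith [Nat.mul_div_le #U k]
  rw [mul_comm]
  exact_mod_cast hunion

theorem exists_densest_subset [Finite V] [Nonempty V] {p : ℝ} (hp : p ≠ 0) :
    ∃ U : Finset V, U.Nonempty ∧ ∀ W : Finset V,
      (#(Rel.interedges E W W) : ℝ) * #U ^ p ≤ #(Rel.interedges E U U) * #W ^ p := by
  have := Fintype.ofFinite V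
  obtain ⟨U, hU, hmax⟩ := exists_max_image ({U | U.Nonempty} : Finset (Finset V))
    (fun U => (#(Rel.interedges E U U) : ℝ) / (#U : ℝ) ^ p) ⟨univ, by simp⟩
  have hcard {W : Finset V} (hW : W.Nonempty) : (0 : ℝ) < (#W : ℝ) ^ p :=
    Real.rpow_pos_of_pos (Nat.cast_pos.2 hW.card_pos) p
  have hU : U.Nonempty := (mem_filter.1 hU).2
  refine ⟨U, hU, fun W => ?_⟩
  obtain rfl | hW := W.eq_empty_or_nonempty
  · simp [Real.zero_rpow hp]
  · exact (div_le_div_iff₀ (hcard hW) (hcard hU)).1 (hmax W (by simpa using hW))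

variable {E}

theorem card_interedges_le_of_densest {U W : Finset V} {p c : ℝ} (hp : 0 ≤ p) (hc : 0 ≤ c)
    (hU : U.Nonempty)
    (hmax : (#(Rel.interedges E W W) : ℝ) * #U ^ p ≤ #(Rel.interedges E U U) * #W ^ p)
    (hW : #W ≤ c * #U) :
    (#(Rel.interedges E W W) : ℝ) ≤ #(Rel.interedges E U U) * c ^ p := by
  have hcard : (0 : ℝ) < #U := Nat.cast_pos.2 hU.card_pos
  refine le_of_mul_le_mul_right ?_ (Real.rpow_pos_of_pos hcard p)
  calc (#(Rel.interedges E W W) : ℝ) * #U ^ p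
      ≤ #(Rel.interedges E U U) * (c * #U) ^ p := hmax.trans (by gcongr)
    _ = #(Rel.interedges E U U) * c ^ p * #U ^ p := by
        rw [Real.mul_rpow hc hcard.le, mul_assoc]

theorem mul_three_div_rpow_le_half {a k : ℝ} (ha : a ≤ 1) (hk : 0 < k) (hka : 18 ≤ k ^ a) :
    k * (3 / k) ^ (1 + a) ≤ 1 / 2 := by
  have hnine : (3 : ℝ) ^ (1 + a) ≤ 9 :=
    calc (3 : ℝ) ^ (1 + a) ≤ 3 ^ (2 : ℝ) :=
          Real.rpow_le_rpow_of_exponent_le (by norm_num) (by linarith)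
      _ = 9 := by norm_num
  calc k * (3 / k) ^ (1 + a) = 3 ^ (1 + a) / k ^ a := by
        rw [Real.div_rpow (by norm_num) hk.le, Real.rpow_add hk, Real.rpow_one]
        field_simp
    _ ≤ 9 / 18 := by gcongr
    _ = 1 / 2 := by norm_num

theorem card_interedges_le_two_mul_sdiff {U H : Finset V} {k : ℕ} {a : ℝ} (ha₀ : 0 ≤ a)
    (ha₁ : a ≤ 1) (hk : k ≠ 0) (hka : 18 ≤ (k : ℝ) ^ a)
    (hmax : ∀ W : Finset V, (#(Rel.interedges E W W) : ℝ) * #U ^ (1 + a) ≤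
      #(Rel.interedges E U U) * #W ^ (1 + a))
    (hkU : k ≤ #U) (hH : k * #H ≤ #U) :
    #(Rel.interedges E U U) ≤ 2 * #(Rel.interedges E (U \ H) (U \ H)) := by
  obtain ⟨P, hcard, hparts⟩ := exists_finpartition_card_union_le hk hkU hH
  have hk' : 0 < (k : ℝ) := Nat.cast_pos.2 (Nat.pos_of_ne_zero hk)
  have hU : U.Nonempty := card_pos.1 (hkU.trans_lt' (Nat.pos_of_ne_zero hk))
  have hsum : ∑ A ∈ P.parts, (#(Rel.interedges E (H ∪ A) (H ∪ A)) : ℝ) ≤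
      #(Rel.interedges E U U) / 2 :=
    calc ∑ A ∈ P.parts, (#(Rel.interedges E (H ∪ A) (H ∪ A)) : ℝ)
        ≤ #P.parts • (#(Rel.interedges E U U) * (3 / k : ℝ) ^ (1 + a)) :=
          sum_le_card_nsmul _ _ _ fun A hA => card_interedges_le_of_densest (by positivity)
            (by positivity) hU (hmax _) (hparts A hA)
      _ = #(Rel.interedges E U U) * (k * (3 / k : ℝ) ^ (1 + a)) := by
          rw [hcard, nsmul_eq_mul]; ring
      _ ≤ #(Rel.interedges E U U) * (1 / 2) := by
          gcongr; exact mul_three_div_rpow_le_half ha₁ hk' hka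
      _ = #(Rel.interedges E U U) / 2 := by ring
  have hcover : (#(Rel.interedges E U U) : ℝ) ≤ #(Rel.interedges E (U \ H) (U \ H)) +
      ∑ A ∈ P.parts, (#(Rel.interedges E (H ∪ A) (H ∪ A)) : ℝ) := by
    exact_mod_cast card_interedges_le_sdiff_add_sum E H P
  have hhalf : (#(Rel.interedges E U U) : ℝ) ≤ 2 * #(Rel.interedges E (U \ H) (U \ H)) := by
    linarith
  exact_mod_cast hhalf

theorem mul_card_highDegree_le {U : Finset V} {k : ℕ} (hE : 0 < #(Rel.interedges E U U)) :
    k * #{v ∈ U | 2 * k * #(Rel.interedges E U U) <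
      #U * (#{w ∈ U | E v w} + #{w ∈ U | E w v})} ≤ #U := by
  set e := #(Rel.interedges E U U) with he
  set H : Finset V := {v ∈ U | 2 * k * e < #U * (#{w ∈ U | E v w} + #{w ∈ U | E w v})}
  refine Nat.le_of_mul_le_mul_right ?_ (Nat.mul_pos two_pos hE)
  calc k * #H * (2 * e) = #H • (2 * k * e) := by rw [smul_eq_mul]; ring
    _ ≤ ∑ v ∈ H, #U * (#{w ∈ U | E v w} + #{w ∈ U | E w v}) :=
        card_nsmul_le_sum _ _ _ fun v hv => (mem_filter.1 hv).2.le
    _ ≤ ∑ v ∈ U, #U * (#{w ∈ U | E v w} + #{w ∈ U | E w v}) :=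
        sum_le_sum_of_subset (filter_subset _ _)
    _ = #U * (2 * e) := by
        rw [← mul_sum, sum_add_distrib, ← card_interedges_eq_sum_out,
          ← card_interedges_eq_sum_in, ← he, two_mul]

theorem exists_almostRegular_subset_of_densest {U : Finset V} {k : ℕ} {a : ℝ} (ha₀ : 0 ≤ a)
    (ha₁ : a ≤ 1) (hk : k ≠ 0) (hka : 18 ≤ (k : ℝ) ^ a)
    (hmax : ∀ W : Finset V, (#(Rel.interedges E W W) : ℝ) * #U ^ (1 + a) ≤
      #(Rel.interedges E U U) * #W ^ (1 + a))
    (hdense : k * #U ≤ #(Rel.interedges E U U)) :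
    ∃ W ⊆ U,
      (∀ v ∈ W, #{w ∈ W | E v w} ≤ 2 * k * #(Rel.interedges E U U) / #U ∧
        #{w ∈ W | E w v} ≤ 2 * k * #(Rel.interedges E U U) / #U) ∧
      #U * (2 * k * #(Rel.interedges E U U) / #U) ≤ 4 * k * #(Rel.interedges E W W) := by
  obtain hU | hU := (#U).eq_zero_or_pos
  · exact ⟨∅, empty_subset _, by simp, by simp [hU]⟩
  set e := #(Rel.interedges E U U)
  have he : 0 < e := (Nat.mul_pos (Nat.pos_of_ne_zero hk) hU).trans_le hdense
  have hkU : k ≤ #U :=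
    Nat.le_of_mul_le_mul_right (hdense.trans (Rel.card_interedges_le_mul E U U)) hU
  set H : Finset V := {v ∈ U | 2 * k * e < #U * (#{w ∈ U | E v w} + #{w ∈ U | E w v})}
  refine ⟨U \ H, sdiff_subset, fun v hv => ?_, ?_⟩
  · obtain ⟨hvU, hvH⟩ := mem_sdiff.1 hv
    have hdeg : #{w ∈ U | E v w} + #{w ∈ U | E w v} ≤ 2 * k * e / #U := by
      rw [Nat.le_div_iff_mul_le hU, mul_comm]
      exact not_lt.1 fun hlt => hvH (mem_filter.2 ⟨hvU, hlt⟩)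
    exact ⟨(card_le_card (filter_subset_filter _ sdiff_subset)).trans
        ((Nat.le_add_right _ _).trans hdeg),
      (card_le_card (filter_subset_filter _ sdiff_subset)).trans
        ((Nat.le_add_left _ _).trans hdeg)⟩
  · calc #U * (2 * k * e / #U) ≤ 2 * k * e := Nat.mul_div_le _ _
      _ ≤ 2 * k * (2 * #(Rel.interedges E (U \ H) (U \ H))) := by
          gcongr
          exact card_interedges_le_two_mul_sdiff ha₀ ha₁ hk hka hmax hkU (mul_card_highDegree_le he)
      _ = 4 * k * #(Rel.interedges E (U \ H) (U \ H)) := by ring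

theorem mul_rpow_mul_card_le_of_densest [Fintype V] [Nonempty V] {U : Finset V} {a C : ℝ}
    (ha : 0 ≤ a) (hC : C * (Fintype.card V : ℝ) ^ (1 + a) ≤ #(Rel.interedges E univ univ))
    (hmax : (#(Rel.interedges E univ univ) : ℝ) * #U ^ (1 + a) ≤
      #(Rel.interedges E U U) * #(univ : Finset V) ^ (1 + a)) :
    C * (#U : ℝ) ^ a * #U ≤ #(Rel.interedges E U U) := by
  refine le_of_mul_le_mul_right ?_
    (Real.rpow_pos_of_pos (Nat.cast_pos.2 (Fintype.card_pos (α := V))) (1 + a))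
  calc C * (#U : ℝ) ^ a * #U * (Fintype.card V : ℝ) ^ (1 + a)
      = C * (Fintype.card V : ℝ) ^ (1 + a) * (#U : ℝ) ^ (1 + a) := by
        rw [Real.rpow_one_add' (Nat.cast_nonneg #U) (by positivity)]; ring
    _ ≤ #(Rel.interedges E univ univ) * (#U : ℝ) ^ (1 + a) := by gcongr
    _ ≤ #(Rel.interedges E U U) * (Fintype.card V : ℝ) ^ (1 + a) := hmax

theorem exists_almostRegular_subset [Fintype V] {k : ℕ} {a C : ℝ} (ha₀ : 0 < a) (ha₁ : a ≤ 1)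
    (hka : 18 ≤ (k : ℝ) ^ a) (hC : 4 * k ≤ C)
    (hlt : C * (Fintype.card V : ℝ) ^ (1 + a) < #(Rel.interedges E univ univ)) :
    ∃ (U : Finset V) (m Δ : ℕ), 0 < m ∧ #U ≤ m ∧
      (∀ v ∈ U, #{w ∈ U | E v w} ≤ Δ ∧ #{w ∈ U | E w v} ≤ Δ) ∧
      m * Δ ≤ 4 * k * #(Rel.interedges E U U) ∧ C * (m : ℝ) ^ a ≤ Δ := by
  have hk : k ≠ 0 := by
    rintro rfl
    norm_num [Real.zero_rpow ha₀.ne'] at hka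
  have hk' : (1 : ℝ) ≤ k := Nat.one_le_cast.2 (Nat.one_le_iff_ne_zero.2 hk)
  have : Nonempty V := by
    by_contra hV
    rw [not_nonempty_iff] at hV
    simp [Real.zero_rpow (by positivity : 1 + a ≠ 0)] at hlt
  obtain ⟨U, hU, hmax⟩ := exists_densest_subset E (by positivity : 1 + a ≠ 0)
  have hdense : C * (#U : ℝ) ^ a * #U ≤ #(Rel.interedges E U U) :=
    mul_rpow_mul_card_le_of_densest ha₀.le hlt.le (hmax univ)
  have hm : (0 : ℝ) < #U := Nat.cast_pos.2 hU.card_pos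
  have hma : 1 ≤ (#U : ℝ) ^ a := Real.one_le_rpow (Nat.one_le_cast.2 hU.card_pos) ha₀.le
  have hkC : k ≤ C * (#U : ℝ) ^ a := by nlinarith
  obtain ⟨W, hWU, hdeg, hedges⟩ := exists_almostRegular_subset_of_densest ha₀.le ha₁ hk hka hmax
    (Nat.cast_le (α := ℝ).1 (by push_cast; exact hdense.trans' (by gcongr)))
  refine ⟨W, #U, _, hU.card_pos, card_le_card hWU, hdeg, hedges, ?_⟩
  set Δ := 2 * k * #(Rel.interedges E U U) / #U
  have hfloor : (2 * k * #(Rel.interedges E U U) : ℝ) < (Δ + 1) * #U := by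
    rw [add_one_mul]
    exact_mod_cast Nat.lt_div_mul_add hU.card_pos
  have hΔ : 2 * k * (C * (#U : ℝ) ^ a) < Δ + 1 := by
    refine lt_of_mul_lt_mul_right ?_ hm.le
    calc 2 * k * (C * (#U : ℝ) ^ a) * #U = 2 * k * (C * (#U : ℝ) ^ a * #U) := by ring
      _ ≤ 2 * k * #(Rel.interedges E U U) := by gcongr
      _ < (Δ + 1) * #U := hfloor
  nlinarith [hΔ]

end AlmostRegularSubset

section Threshold

/-- `vw` is an edge of `G` with `v` in `X` and `w` outside `X`: the edges of `G[X, Xᶜ]`, oriented so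
that each of them is a single pair. -/
def CrossAdj {V : Type*} (G : SimpleGraph V) (X : Set V) (v w : V) : Prop :=
  v ∈ X ∧ w ∉ X ∧ G.Adj v w

theorem ncard_edgeSet_between_le {V : Type*} [Fintype V] (G : SimpleGraph V) (X : Set V) :
    (G.between X Xᶜ).edgeSet.ncard ≤ #(Rel.interedges (CrossAdj G X) univ univ) := by
  have himage : (G.between X Xᶜ).edgeSet ⊆
      ((Rel.interedges (CrossAdj G X) univ univ).image Sym2.mk.uncurry : Finset (Sym2 V)) := by
    intro e
    induction e with | _ v w
    simp only [SimpleGraph.mem_edgeSet, SimpleGraph.between_adj, coe_image, Set.mem_image, mem_coe]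
    rintro ⟨hadj, ⟨hv, hw⟩ | ⟨hv, hw⟩⟩
    · exact ⟨(v, w), by simpa [Rel.mk_mem_interedges_iff] using ⟨hv, hw, hadj⟩, rfl⟩
    · exact ⟨(w, v), by simpa [Rel.mk_mem_interedges_iff] using ⟨hw, hv, hadj.symm⟩, Sym2.eq_swap⟩
  refine (Set.ncard_le_ncard himage (finite_toSet _)).trans ?_
  rw [Set.ncard_coe_finset]
  exact card_image_le

theorem card_interedges_crossAdj_le {V : Type*} [Fintype V] (G : SimpleGraph V) (X : Set V)
    (U : Finset V) :
    #(Rel.interedges (CrossAdj G X) U U) ≤ ∑ w : {w // w ∈ U ∧ w ∉ X},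
      #(leftNbrs (G.comap (Sum.elim (Subtype.val : {v // v ∈ U ∧ v ∈ X} → V) Subtype.val)) w) := by
  set G' := G.comap (Sum.elim (Subtype.val : {v // v ∈ U ∧ v ∈ X} → V)
    (Subtype.val : {w // w ∈ U ∧ w ∉ X} → V))
  have himage : Rel.interedges (CrossAdj G X) U U ⊆
      (univ.sigma (leftNbrs G')).image fun p => (p.2.1, p.1.1) := by
    rintro ⟨v, w⟩ hvw
    obtain ⟨hv, hw, hvX, hwX, hadj⟩ := Rel.mk_mem_interedges_iff.1 hvw
    exact mem_image.2 ⟨⟨⟨w, hw, hwX⟩, ⟨v, hv, hvX⟩⟩,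
      mem_sigma.2 ⟨mem_univ _, mem_filter.2 ⟨mem_univ _, hadj⟩⟩, rfl⟩
  exact (card_le_card himage).trans (card_image_le.trans (card_sigma _ _).le)

theorem almostRegular_comap {V : Type*} [Fintype V] {G : SimpleGraph V} {X : Set V}
    {U : Finset V} {m Δ K : ℕ} (hU : #U ≤ m)
    (hdeg : ∀ v ∈ U, #{w ∈ U | CrossAdj G X v w} ≤ Δ ∧ #{w ∈ U | CrossAdj G X w v} ≤ Δ)
    (hedges : m * Δ ≤ K * #(Rel.interedges (CrossAdj G X) U U)) :
    AlmostRegular (α := {v // v ∈ U ∧ v ∈ X}) (β := {v // v ∈ U ∧ v ∉ X})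
      (G.comap (Sum.elim Subtype.val Subtype.val)) m Δ K where
  card_left := by
    rw [Fintype.card_subtype]
    exact (card_le_card fun v hv => (mem_filter.1 hv).2.1).trans hU
  card_right := by
    rw [Fintype.card_subtype]
    exact (card_le_card fun v hv => (mem_filter.1 hv).2.1).trans hU
  card_leftNbrs_le b := (hdeg b.1 b.2.1).2.trans' <|
    card_le_card_of_injOn Subtype.val
      (fun v hv => mem_filter.2 ⟨v.2.1, v.2.2, b.2.2, (mem_filter.1 hv).2⟩)
      Subtype.val_injective.injOn
  card_rightNbrs_le a := (hdeg a.1 a.2.1).1.trans' <|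
    card_le_card_of_injOn Subtype.val
      (fun v hv => mem_filter.2 ⟨v.2.1, a.2.2, v.2.2, (mem_filter.1 hv).2⟩)
      Subtype.val_injective.injOn
  le_mul_sum := hedges.trans (Nat.mul_le_mul_left _ (card_interedges_crossAdj_le G X U))

theorem mul_rpow_mul_le_pow {a C m Δ : ℝ} {q : ℕ} (hC : 1 ≤ C) (hm : 0 ≤ m)
    (hΔ : C * m ^ a ≤ Δ) (hq : q ≠ 0) : C * m ^ (a * q) ≤ Δ ^ q :=
  calc C * m ^ (a * q) ≤ C ^ q * m ^ (a * q) := by gcongr; exact le_self_pow₀ hC hq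
    _ = (C * m ^ a) ^ q := by rw [mul_pow, Real.rpow_mul_natCast hm]
    _ ≤ Δ ^ q := by gcongr

theorem mul_pow_sq_le_pow {r t : ℕ} {C m Δ : ℝ} (ht : 1 ≤ t) (hr : t + 2 ≤ r) (hC : 1 ≤ C)
    (hm : 1 ≤ m) (hΔ : C * m ^ ((r * t - 1) / (r * (t + 1)) : ℝ) ≤ Δ) :
    C * m ^ t ^ 2 ≤ Δ ^ (t ^ 2 + t + 1) := by
  refine (mul_rpow_mul_le_pow hC (by positivity) hΔ (Nat.succ_ne_zero _)).trans' ?_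
  have htr : (1 : ℝ) ≤ t := Nat.one_le_cast.2 ht
  have hrr : (t + 2 : ℝ) ≤ r := by exact_mod_cast hr
  have hr₀ : (0 : ℝ) < r := by linarith
  rw [← Real.rpow_natCast]
  refine mul_le_mul_of_nonneg_left (Real.rpow_le_rpow_of_exponent_le hm ?_) (by linarith)
  rw [div_mul_eq_mul_div, le_div_iff₀ (by positivity)]
  push_cast
  nlinarith [mul_nonneg (sub_nonneg.2 htr) (sub_nonneg.2 hrr)]

theorem mul_pow_mul_le_mul_pow {r t : ℕ} {C m Δ : ℝ} (hr : r ≠ 0) (hC : 1 ≤ C) (hm : 0 < m)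
    (hΔ : C * m ^ ((r * t - 1) / (r * (t + 1)) : ℝ) ≤ Δ) :
    C * m ^ (r * t) ≤ m * Δ ^ (r * (t + 1)) := by
  have hpow := mul_rpow_mul_le_pow hC hm.le hΔ (mul_ne_zero hr t.succ_ne_zero)
  have hexp : ((r * t - 1) / (r * (t + 1)) : ℝ) * ((r * (t + 1) : ℕ) : ℝ) = (r * t : ℕ) - 1 := by
    push_cast
    field_simp
  rw [hexp, Real.rpow_sub_one hm.ne', Real.rpow_natCast] at hpow
  calc C * m ^ (r * t) = m * (C * (m ^ (r * t) / m)) := by field_simp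
    _ ≤ m * Δ ^ (r * (t + 1)) := by gcongr

theorem exists_hasInducedCopyAcross (ℓ r s t : ℕ) (ht : 1 ≤ t) (hr : t + 2 ≤ r) :
    ∃ C : ℝ, 0 < C ∧ ∀ {V : Type*} [Fintype V] {G : SimpleGraph V} {X : Set V},
      (completeBipartiteGraph (Fin s) (Fin s)).Free G →
      C * (Fintype.card V : ℝ) ^ (1 + (r * t - 1) / (r * (t + 1)) : ℝ) <
        (G.between X Xᶜ).edgeSet.ncard →
      HasInducedCopyAcross (heightTwoPower r t ℓ) G X := by
  set a : ℝ := (r * t - 1) / (r * (t + 1)) with ha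
  have hrt : (1 : ℝ) < r * t := by exact_mod_cast (by nlinarith : 1 < r * t)
  have hr₀ : (0 : ℝ) < r := Nat.cast_pos.2 (by omega)
  have ha₀ : 0 < a := div_pos (by linarith) (by positivity)
  have ha₁ : a ≤ 1 := by rw [ha, div_le_one (by positivity)]; linarith
  obtain ⟨k, hka, hk⟩ : ∃ k : ℕ, 18 ≤ (k : ℝ) ^ a ∧ 0 < k :=
    (((tendsto_rpow_atTop ha₀).comp tendsto_natCast_atTop_atTop).eventually_ge_atTop 18
      |>.and (Filter.eventually_gt_atTop 0)).exists
  obtain ⟨C, hC, hpower⟩ := exists_hasPower_of_almostRegular s r t ℓ (4 * k) (by omega)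
    (by positivity)
  refine ⟨C + 4 * k, by positivity, fun {V} _ {G X} hfree hlt => ?_⟩
  have hk₁ : (1 : ℝ) ≤ k := Nat.one_le_cast.2 hk
  obtain ⟨U, m, Δ, hm, hUm, hdeg, hedges, hΔ⟩ := exists_almostRegular_subset ha₀ ha₁ hka
    (by linarith) (hlt.trans_le (Nat.cast_le.2 (ncard_edgeSet_between_le G X)))
  have hm₁ : (1 : ℝ) ≤ m := Nat.one_le_cast.2 hm
  have hinj : Injective (Sum.elim (Subtype.val : {v // v ∈ U ∧ v ∈ X} → V)
      (Subtype.val : {v // v ∈ U ∧ v ∉ X} → V)) :=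
    Subtype.val_injective.sumElim Subtype.val_injective
      fun v w h => w.2.2 (h ▸ v.2.2)
  have hCk : C ≤ C + 4 * k := by linarith
  refine HasPower.hasInducedCopyAcross (f := Subtype.val) (g := Subtype.val) (by omega) ht hinj
    (fun v => v.2.2) (fun v => v.2.2)
    (hpower ?_ (almostRegular_comap hUm hdeg hedges) hm ?_ ?_ ?_)
  · exact fun hcopy => hfree (hcopy.trans ⟨(SimpleGraph.Embedding.comap ⟨_, hinj⟩ G).toCopy⟩)
  · have := Real.one_le_rpow hm₁ ha₀.le
    nlinarith
  · exact (mul_pow_sq_le_pow ht hr (by linarith) hm₁ hΔ).trans' (by gcongr)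
  · exact (mul_pow_mul_le_mul_pow (by omega) (by linarith) (by linarith) hΔ).trans' (by gcongr)

theorem exists_isThreshold (ℓ r s t : ℕ) (ht : 1 ≤ t) (hr : t + 2 ≤ r) :
    ∃ C : ℝ, 0 < C ∧ ∀ n : ℕ, IsThreshold n (heightTwoPower r t ℓ) s
      ⌊C * (n : ℝ) ^ (2 - ((r : ℝ) + 1) / ((r : ℝ) * t + r))⌋₊ := by
  obtain ⟨C, hC, hcopy⟩ := exists_hasInducedCopyAcross ℓ r s t ht hr
  refine ⟨C, hC, fun n G X hfree hlt => hcopy hfree ?_⟩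
  have hexp : 2 - ((r : ℝ) + 1) / (r * t + r) = 1 + (r * t - 1) / (r * (t + 1)) := by
    have hr₀ : (r : ℝ) ≠ 0 := Nat.cast_ne_zero.2 (by omega)
    field_simp
    ring
  rw [Fintype.card_fin, ← hexp]
  exact Nat.lt_of_floor_lt hlt

end Threshold

end InducedTuran

theorem theorem2p3 (ℓ r s t : ℕ) (hℓ : 1 ≤ ℓ) (hs : 1 ≤ s) (ht : 3 ≤ t + 2) (hr : t + 2 ≤ r) :
    (fun n : ℕ => (InducedTuran.exBip n (InducedTuran.heightTwoPower r t ℓ) s : ℝ))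
      =O[Filter.atTop]
    (fun n : ℕ => (n : ℝ) ^ (2 - ((r : ℝ) + 1) / ((r : ℝ) * (t : ℝ) + (r : ℝ)))) := by
  obtain ⟨C, hC, h⟩ := InducedTuran.exists_isThreshold ℓ r s t (by omega) hr
  refine Asymptotics.IsBigO.of_bound C (Filter.Eventually.of_forall fun n => ?_)
  have hn : (0 : ℝ) ≤ (n : ℝ) ^ (2 - ((r : ℝ) + 1) / ((r : ℝ) * (t : ℝ) + (r : ℝ))) := by positivity
  rw [Real.norm_of_nonneg (Nat.cast_nonneg _), Real.norm_of_nonneg hn]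
  refine le_trans ?_ (Nat.floor_le (mul_nonneg hC.le hn))
  exact Nat.cast_le.2 (Nat.sInf_le (h n))
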